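/- Let $0 \le s \le n$ be integers and let $\mathcal D_{n,s}$ be the arrangement of linear hyperplanes in $\mathbb R^n$ with normal vectors $e_i \pm e_j$ ($1 \le i < j \le n$) and $e_i$ ($1 \le i \le s$). Assume that $\mathcal D_{n,s}$ is non-empty, i.e. $n \ge 2$ or $n = s = 1$. The chambers of $\mathcal D_{n,s}$ are the closures of the connected components of $\mathbb R^n \setminus \bigcup_{H \in \mathcal D_{n,s}} H$; its cones are the intersections of non-empty sets of chambers; its rays are the cones whose linear span is one-dimensional; and $\Delta_{n,s}$ denotes the complex whose simplices are the sets $\{r \text{ a ray} : r \subseteq K\}$, where $K$ runs over all cones. Let $d-1$ be the dimension of $\Delta_{n,s}$, let $f_k$ be the number of its $k$-dimensional simplices ($f_{-1}=1$), and let $h(t) = \sum_{i=0}^{d} f_{d-1-i}\,(t-1)^i$. Then $\mathcal D_{n,s}$ is simplicial (for every chamber $C$, the normals of the hyperplanes spanned by the walls of $C$ are linearly independent, a wall of $C$ being an intersection of $C$ with a chamber that spans a subspace of codimension one), and $\mathcal D_{n,s}$ is $\gamma$-positive: there are integers $\gamma_0, \dots, \gamma_{\lfloor d/2\rfloor} \ge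 0$ (necessarily unique) with $$h(t) = \sum_{i=0}^{\lfloor d/2 \rfloor} \gamma_i\, t^i (1+t)^{d-2i}.$$ -/

import Mathlib

namespace HypArr

open Polynomial

/-- The linear hyperplane `H_α = {x ∈ ℝⁿ | α₁ x₁ + ⋯ + αₙ xₙ = 0}` with normal `α`
(a hyperplane when `α ≠ 0`). -/
def hyperplane {n : ℕ} (α : Fin n → ℝ) : Submodule ℝ (Fin n → ℝ) where
  carrier := {x | ∑ i, α i * x i = 0}
  add_mem' := by
    intro a b ha hb
    simp only [Set.mem_setOf_eq, Pi.add_apply, mul_add, Finset.sum_add_distrib] at *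
    rw [ha, hb, add_zero]
  zero_mem' := by simp
  smul_mem' := by
    intro c x hx
    simp only [Set.mem_setOf_eq, Pi.smul_apply, smul_eq_mul] at *
    have h : ∑ i, α i * (c * x i) = c * ∑ i, α i * x i := by
      rw [Finset.mul_sum]
      exact Finset.sum_congr rfl fun i _ => by ring
    rw [h, hx, mul_zero]

/-- The intermediate arrangement `𝒟_{n,s}` in `ℝⁿ`: the hyperplanes with normals `e_i ± e_j` for
`i < j`, and `e_i` for the first `s` indices `i` (indices start at `0` here). -/
def intermediate (n s : ℕ) : Set (Submodule ℝ (Fin n → ℝ)) :=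
  {H | (∃ i j : Fin n, i < j ∧
          (H = hyperplane (Pi.single i 1 + Pi.single j 1) ∨
            H = hyperplane (Pi.single i 1 - Pi.single j 1))) ∨
        ∃ i : Fin n, (i : ℕ) < s ∧ H = hyperplane (Pi.single i 1)}

section Arrangement

variable {n : ℕ} (A : Set (Submodule ℝ (Fin n → ℝ)))

/-- The complement `ℝⁿ \ ⋃ H` of an arrangement. -/
def complement : Set (Fin n → ℝ) := {x | ∀ H ∈ A, x ∉ H}

/-- Chambers: closures of the connected components of the complement. -/
def chambers : Set (Set (Fin n → ℝ)) :=
  {C | ∃ x ∈ complement A, C = closure (connectedComponentIn (complement A) x)}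

/-- The supporting hyperplanes of the walls of `C`. A wall of `C` is an intersection `C ∩ C'` with
a chamber `C'` that spans a subspace of codimension one, and this span is its supporting
hyperplane. -/
def wallSpans (C : Set (Fin n → ℝ)) : Set (Submodule ℝ (Fin n → ℝ)) :=
  {H | ∃ C' ∈ chambers A, H = Submodule.span ℝ (C ∩ C') ∧ Module.finrank ℝ H + 1 = n}

/-- An arrangement is simplicial if for every chamber the normals of the supporting hyperplanes of
its walls are linearly independent. -/
def IsSimplicial : Prop :=
  ∀ C ∈ chambers A, ∃ α : wallSpans A C → (Fin n → ℝ),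
    (∀ H : wallSpans A C, (H : Submodule ℝ (Fin n → ℝ)) = hyperplane (α H)) ∧
      LinearIndependent ℝ α

/-- Cones: the intersections of (nonempty) sets of chambers. -/
def cones : Set (Set (Fin n → ℝ)) :=
  {K | ∃ S : Set (Set (Fin n → ℝ)), S ⊆ chambers A ∧ S.Nonempty ∧ K = ⋂₀ S}

/-- Rays: the cones of dimension one, the dimension being that of the linear span. -/
def rays : Set (Set (Fin n → ℝ)) :=
  {r | r ∈ cones A ∧ Module.finrank ℝ (Submodule.span ℝ r) = 1}

/-- The complex `Δ_A` on the vertex set `rays A`: its simplices are the sets of all rays that lie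
in some given cone. The empty simplex comes from the cone `{0}`. -/
def complex : Set (Set (Set (Fin n → ℝ))) :=
  {σ | ∃ K ∈ cones A, σ = {r | r ∈ rays A ∧ r ⊆ K}}

end Arrangement

section Complex

/- Here `Δ` is a finite simplicial complex, given as the set of all its simplices, each simplex
being the set of its vertices; the empty simplex is included. -/
variable {V : Type*} (Δ : Set (Set V))

/-- The number of simplices with exactly `k` vertices, that is `f_{k-1}`. -/
noncomputable def numFaces (k : ℕ) : ℕ := {σ | σ ∈ Δ ∧ σ.encard = k}.ncard

/-- The number `d` for which `Δ` has dimension `d - 1`: the largest number of vertices of a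
simplex. -/
noncomputable def size : ℕ := sSup {k : ℕ | ∃ σ ∈ Δ, σ.encard = k}

/-- The `f`-polynomial `∑_{i=0}^d f_{d-1-i} tⁱ`. -/
noncomputable def fPoly : ℤ[X] :=
  ∑ i ∈ Finset.range (size Δ + 1), C (numFaces Δ (size Δ - i) : ℤ) * X ^ i

/-- The `h`-polynomial `h(t) = f(t - 1)`. -/
noncomputable def hPoly : ℤ[X] := (fPoly Δ).comp (X - 1)

/-- `γ = (γ_0, …, γ_{⌊d/2⌋})` is the `γ`-vector of `Δ`:
`h(t) = ∑_{i=0}^{⌊d/2⌋} γ_i tⁱ (1 + t)^{d - 2i}`. -/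
def IsGammaVector (γ : Fin (size Δ / 2 + 1) → ℤ) : Prop :=
  hPoly Δ = ∑ i, C (γ i) * X ^ (i : ℕ) * (1 + X) ^ (size Δ - 2 * (i : ℕ))

/-- `Δ` has a `γ`-vector (there is at most one, as the polynomials `tⁱ (1 + t)^{d - 2i}` are
linearly independent), and its entries are nonnegative. -/
def IsGammaPositive : Prop :=
  ∃ γ : Fin (size Δ / 2 + 1) → ℤ, IsGammaVector Δ γ ∧ ∀ i, 0 ≤ γ i

end Complex

end HypArr

/-!
Every closed face of an arrangement is the set `face Φ x` of points whose signs on all normals agree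
weakly with those of a point `x` in its relative interior. The chambers are the faces of generic
points, and the cones are all the faces (`chambers_image`, `cones_image`).

If each chamber has a simple system, that is generators `v` whose dual basis consists of normals up
to sign, then a face is generated by the `v i` it contains. Hence the arrangement is simplicial, the
number of rays in a face is its dimension, and a face is determined by its rays. So the complex has
one simplex with `k` vertices for each `k`-dimensional face (`HasSimpleSystems.numFaces_complex`). For
`𝒟_{n,s}` the simple systems are those of type `B` or `D`, depending on whether the coordinate of
least absolute value is among the first `s` (`hasSimpleSystems_normals`).

Faces are counted by lattice points. Points of one face of `𝒟_{n,s}` have the same coordinate signs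
and the same order of absolute values, except that a coordinate outside the first `s` with strictly
smallest absolute value may vary. With this coordinate required to be positive, a face of dimension
`k` contains one integer point for each choice of `k` positive absolute values, so
`∑ₖ fₖ (m.choose k)` is the number of normalized points in the box `[-m, m]ⁿ`, which is
`(2m+1)ⁿ - (n-s) ∑_{c ≤ m} (2c)ⁿ⁻¹` (`card_normalizedBox`, `card_normalizedBox_add`). Therefore
`h(t) = Bₙ(t) - (n-s) 2ⁿ⁻¹ t Aₙ₋₁(t)` with the Eulerian polynomials of types `B` and `A`
(`sum_facesOfDim`).

Both Eulerian polynomials satisfy first-order differential recursions, which act on `γ`-vectors and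
identify these with peak numbers of permutations: left peaks for `B`, interior peaks for `A`. The
`γ`-vector of `h` is nonnegative because, among the words obtained by putting a letter in front of a
permutation with `i` interior peaks, at least half have `i + 1` left peaks
(`mul_peak_le_leftPeak`). Peak numbers appear only through their recursions here.
-/

namespace HypArr

open Polynomial

/-! ### Faces of an arrangement -/

section Face

variable {n : ℕ}

lemma mem_hyperplane {a x : Fin n → ℝ} : x ∈ hyperplane a ↔ a ⬝ᵥ x = 0 := Iff.rfl

/-- The closed face of the arrangement with normals `Φ` whose relative interior contains `x`: the
points at which the sign of each normal is that at `x` or zero. -/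
def face (Φ : Set (Fin n → ℝ)) (x : Fin n → ℝ) : Set (Fin n → ℝ) :=
  {y | ∀ a ∈ Φ, (0 ≤ a ⬝ᵥ x → 0 ≤ a ⬝ᵥ y) ∧ (a ⬝ᵥ x ≤ 0 → a ⬝ᵥ y ≤ 0)}

/-- A point is generic if it lies on no hyperplane. -/
def Generic (Φ : Set (Fin n → ℝ)) (x : Fin n → ℝ) : Prop := ∀ a ∈ Φ, a ⬝ᵥ x ≠ 0

variable {Φ : Set (Fin n → ℝ)} {x y z : Fin n → ℝ}

lemma self_mem_face : x ∈ face Φ x := fun _ _ => ⟨id, id⟩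

lemma face_subset (h : y ∈ face Φ x) : face Φ y ⊆ face Φ x :=
  fun _ hz a ha => ⟨fun h' => (hz a ha).1 ((h a ha).1 h'), fun h' => (hz a ha).2 ((h a ha).2 h')⟩

lemma face_eq_face_iff : face Φ x = face Φ y ↔ x ∈ face Φ y ∧ y ∈ face Φ x :=
  ⟨fun h => ⟨h ▸ self_mem_face, h ▸ self_mem_face⟩,
    fun h => (face_subset h.1).antisymm (face_subset h.2)⟩

lemma add_mem_face (hy : y ∈ face Φ x) (hz : z ∈ face Φ x) : y + z ∈ face Φ x := fun a ha => by
  rw [dotProduct_add]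
  exact ⟨fun h => add_nonneg ((hy a ha).1 h) ((hz a ha).1 h),
    fun h => add_nonpos ((hy a ha).2 h) ((hz a ha).2 h)⟩

lemma smul_mem_face {c : ℝ} (hc : 0 ≤ c) (hy : y ∈ face Φ x) : c • y ∈ face Φ x := fun a ha => by
  rw [dotProduct_smul, smul_eq_mul]
  exact ⟨fun h => mul_nonneg hc ((hy a ha).1 h),
    fun h => mul_nonpos_of_nonneg_of_nonpos hc ((hy a ha).2 h)⟩

lemma zero_mem_face : 0 ∈ face Φ x := fun a _ => by simp

lemma sum_mem_face {ι : Type*} {s : Finset ι} {f : ι → Fin n → ℝ} (h : ∀ i ∈ s, f i ∈ face Φ x) :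
    ∑ i ∈ s, f i ∈ face Φ x :=
  Finset.sum_induction f (· ∈ face Φ x) (fun _ _ => add_mem_face) zero_mem_face h

lemma convex_face : Convex ℝ (face Φ x) := fun _ hy _ hz _ _ ha hb _ =>
  add_mem_face (smul_mem_face ha hy) (smul_mem_face hb hz)

lemma continuous_dot (a : Fin n → ℝ) : Continuous fun x : Fin n → ℝ => a ⬝ᵥ x := by
  unfold dotProduct; fun_prop

lemma isClosed_face : IsClosed (face Φ x) := by
  have : face Φ x = ⋂ a ∈ Φ, ({y | 0 ≤ a ⬝ᵥ x → 0 ≤ a ⬝ᵥ y} ∩ {y | a ⬝ᵥ x ≤ 0 → a ⬝ᵥ y ≤ 0}) := by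
    ext y; simp [face]
  rw [this]
  refine isClosed_biInter fun a _ => IsClosed.inter ?_ ?_
  · by_cases h : 0 ≤ a ⬝ᵥ x
    · simpa [h] using isClosed_le continuous_const (continuous_dot a)
    · simp [h]
  · by_cases h : a ⬝ᵥ x ≤ 0
    · simpa [h] using isClosed_le (continuous_dot a) continuous_const
    · simp [h]

/-- Moving from `x` by a small step changes the sign of no normal that does not vanish at `x`. -/
lemma exists_small_step (hΦ : Φ.Finite) (x z : Fin n → ℝ) :
    ∃ ε : ℝ, 0 < ε ∧ ∀ a ∈ Φ, a ⬝ᵥ x ≠ 0 → |ε * a ⬝ᵥ z| < |a ⬝ᵥ x| := by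
  have h : ∀ᶠ ε : ℝ in nhdsWithin 0 (Set.Ioi 0), ∀ a ∈ Φ, a ⬝ᵥ x ≠ 0 → |ε * a ⬝ᵥ z| < |a ⬝ᵥ x| := by
    rw [Filter.eventually_all_finite hΦ]
    intro a _
    rw [Filter.eventually_imp_distrib_left]
    intro ha
    have hc : ContinuousAt (fun ε : ℝ => |ε * a ⬝ᵥ z|) 0 := by fun_prop
    refine (hc.eventually_lt continuousAt_const ?_).filter_mono nhdsWithin_le_nhds
    simpa using ha
  obtain ⟨ε, h1, h2⟩ := (h.and self_mem_nhdsWithin).exists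
  exact ⟨ε, h2, h1⟩

/-- Every face is the intersection of two opposite chambers. -/
lemma exists_generic_inter_eq_face (hΦ : Φ.Finite) {u : Fin n → ℝ} (hu : Generic Φ u)
    (x : Fin n → ℝ) : ∃ c c', Generic Φ c ∧ Generic Φ c' ∧ face Φ x = face Φ c ∩ face Φ c' := by
  obtain ⟨ε, h0, hε⟩ := exists_small_step hΦ x u
  have hdot (a : Fin n → ℝ) : a ⬝ᵥ (x + ε • u) = a ⬝ᵥ x + ε * a ⬝ᵥ u := by
    rw [dotProduct_add, dotProduct_smul, smul_eq_mul]
  have hdot' (a : Fin n → ℝ) : a ⬝ᵥ (x - ε • u) = a ⬝ᵥ x - ε * a ⬝ᵥ u := by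
    rw [dotProduct_sub, dotProduct_smul, smul_eq_mul]
  refine ⟨x + ε • u, x - ε • u, fun a ha => ?_, fun a ha => ?_, ?_⟩
  · rw [hdot]
    by_cases hx : a ⬝ᵥ x = 0
    · simpa [hx] using ⟨h0.ne', hu a ha⟩
    · intro h
      have := hε a ha hx
      rw [show ε * a ⬝ᵥ u = -(a ⬝ᵥ x) by linarith, abs_neg] at this
      exact lt_irrefl _ this
  · rw [hdot']
    by_cases hx : a ⬝ᵥ x = 0
    · simpa [hx] using ⟨h0.ne', hu a ha⟩
    · intro h
      have := hε a ha hx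
      rw [show ε * a ⬝ᵥ u = a ⬝ᵥ x by linarith] at this
      exact lt_irrefl _ this
  · refine Set.Subset.antisymm (Set.subset_inter ?_ ?_) fun y hy a ha => ?_
    · refine face_subset fun a ha => ?_
      rw [hdot]
      by_cases hx : a ⬝ᵥ x = 0
      · simp [hx]
      · have := abs_lt.1 (hε a ha hx)
        rcases abs_cases (a ⬝ᵥ x) with h | h <;> constructor <;> intro <;> linarith
    · refine face_subset fun a ha => ?_
      rw [hdot']
      by_cases hx : a ⬝ᵥ x = 0
      · simp [hx]
      · have := abs_lt.1 (hε a ha hx)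
        rcases abs_cases (a ⬝ᵥ x) with h | h <;> constructor <;> intro <;> linarith
    · have h1 := hy.1 a ha
      have h2 := hy.2 a ha
      rw [hdot] at h1
      rw [hdot'] at h2
      by_cases hx : a ⬝ᵥ x = 0
      · rw [hx] at h1 h2 ⊢
        rcases le_total 0 (ε * a ⬝ᵥ u) with h | h
        · exact ⟨fun _ => h1.1 (by linarith), fun _ => h2.2 (by linarith)⟩
        · exact ⟨fun _ => h2.1 (by linarith), fun _ => h1.2 (by linarith)⟩
      · have := abs_lt.1 (hε a ha hx)
        rcases abs_cases (a ⬝ᵥ x) with h | h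
        · exact ⟨fun _ => h1.1 (by linarith), fun _ => by
            exact absurd (h.2.lt_of_ne' hx) (by linarith)⟩
        · exact ⟨fun _ => by linarith, fun _ => h1.2 (by linarith)⟩

lemma mem_complement_image {x : Fin n → ℝ} :
    x ∈ complement (hyperplane '' Φ) ↔ Generic Φ x := by
  simp [complement, Generic, mem_hyperplane]

/-- The closures of the connected components of the complement are the faces of generic points. -/
lemma chambers_image : chambers (hyperplane '' Φ) = {K | ∃ c, Generic Φ c ∧ K = face Φ c} := by
  have key {c : Fin n → ℝ} (hc : Generic Φ c) :
      closure (connectedComponentIn (complement (hyperplane '' Φ)) c) = face Φ c := by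
    have hcomp : connectedComponentIn (complement (hyperplane '' Φ)) c
        = face Φ c ∩ {y | Generic Φ y} := by
      refine Set.Subset.antisymm (fun y hy => ⟨fun a ha => ?_, ?_⟩) ?_
      · have hpre : IsPreconnected ((fun z => a ⬝ᵥ z) ''
            connectedComponentIn (complement (hyperplane '' Φ)) c) :=
          isPreconnected_connectedComponentIn.image _ (continuous_dot a).continuousOn
        have hc' := mem_connectedComponentIn (mem_complement_image.2 hc)
        have hne : (0 : ℝ) ∉ (fun z => a ⬝ᵥ z) ''
            connectedComponentIn (complement (hyperplane '' Φ)) c := by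
          rintro ⟨z, hz, h0⟩
          exact mem_complement_image.1 (connectedComponentIn_subset _ _ hz) a ha h0
        refine ⟨fun h => ?_, fun h => ?_⟩ <;> by_contra! h'
        · exact hne (hpre.ordConnected.out ⟨y, hy, rfl⟩ ⟨c, hc', rfl⟩ ⟨h'.le, h⟩)
        · exact hne (hpre.ordConnected.out ⟨c, hc', rfl⟩ ⟨y, hy, rfl⟩ ⟨h, h'.le⟩)
      · exact mem_complement_image.1 (connectedComponentIn_subset _ _ hy)
      · refine IsPreconnected.subset_connectedComponentIn ?_ ⟨self_mem_face, hc⟩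
          fun y hy => mem_complement_image.2 hy.2
        refine Convex.isPreconnected fun y hy z hz p q hp hq hpq =>
          ⟨convex_face hy.1 hz.1 hp hq hpq, fun a ha h => ?_⟩
        rw [dotProduct_add, dotProduct_smul, dotProduct_smul, smul_eq_mul, smul_eq_mul] at h
        have hy2 := hy.2 a ha
        have hz2 := hz.2 a ha
        have hy1 := hy.1 a ha
        have hz1 := hz.1 a ha
        rcases le_total 0 (a ⬝ᵥ c) with h0 | h0
        · have h1 := (hy1.1 h0).lt_of_ne' hy2
          have h2 := (hz1.1 h0).lt_of_ne' hz2
          rcases hp.eq_or_lt with rfl | hp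
          · rw [show q = 1 by linarith] at h; linarith
          · have := mul_pos hp h1; have := mul_nonneg hq h2.le; linarith
        · have h1 := (hy1.2 h0).lt_of_ne hy2
          have h2 := (hz1.2 h0).lt_of_ne hz2
          rcases hp.eq_or_lt with rfl | hp
          · rw [show q = 1 by linarith] at h; linarith
          · have := mul_neg_of_pos_of_neg hp h1
            have := mul_nonpos_of_nonneg_of_nonpos hq h2.le; linarith
    rw [hcomp]
    refine Set.Subset.antisymm (closure_minimal Set.inter_subset_left isClosed_face) fun y hy => ?_
    have hlim : Filter.Tendsto (fun ε : ℝ => y + ε • c) (nhdsWithin 0 (Set.Ioi 0)) (nhds y) := by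
      have : ContinuousAt (fun ε : ℝ => y + ε • c) 0 := by fun_prop
      simpa [ContinuousAt] using this.tendsto.mono_left nhdsWithin_le_nhds
    refine mem_closure_of_tendsto hlim ?_
    filter_upwards [self_mem_nhdsWithin] with ε hε
    have hε : 0 < ε := hε
    refine ⟨add_mem_face hy (smul_mem_face hε.le self_mem_face), fun a ha => ?_⟩
    rw [dotProduct_add, dotProduct_smul, smul_eq_mul]
    have hy := hy a ha
    rcases lt_or_gt_of_ne (hc a ha) with h | h
    · have := hy.2 h.le; have := mul_neg_of_pos_of_neg hε h; exact ne_of_lt (by linarith)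
    · have := hy.1 h.le; have := mul_pos hε h; exact ne_of_gt (by linarith)
  ext K
  constructor
  · rintro ⟨c, hc, rfl⟩
    exact ⟨c, mem_complement_image.1 hc, key (mem_complement_image.1 hc)⟩
  · rintro ⟨c, hc, rfl⟩
    exact ⟨c, mem_complement_image.2 hc, (key hc).symm⟩

/-- The cones are the closed faces. An intersection `K` of chambers is the face of any point of
`K` off as many of the hyperplanes as possible. -/
lemma cones_image (hΦ : Φ.Finite) {u : Fin n → ℝ} (hu : Generic Φ u) :
    cones (hyperplane '' Φ) = Set.range (face Φ) := by
  ext K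
  constructor
  · rintro ⟨S, hS, ⟨C, hC⟩, rfl⟩
    rw [chambers_image] at hS
    have hadd : ∀ y ∈ ⋂₀ S, ∀ z ∈ ⋂₀ S, y + z ∈ ⋂₀ S := fun y hy z hz D hD => by
      obtain ⟨c, -, rfl⟩ := hS hD
      exact add_mem_face (hy _ hD) (hz _ hD)
    have h0 : (0 : Fin n → ℝ) ∈ ⋂₀ S := fun D hD => by
      obtain ⟨c, -, rfl⟩ := hS hD
      exact zero_mem_face
    have hw (a : Fin n → ℝ) : ∃ w ∈ ⋂₀ S, (∃ z ∈ ⋂₀ S, a ⬝ᵥ z ≠ 0) → a ⬝ᵥ w ≠ 0 := by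
      by_cases h : ∃ z ∈ ⋂₀ S, a ⬝ᵥ z ≠ 0
      · obtain ⟨z, hz, h⟩ := h
        exact ⟨z, hz, fun _ => h⟩
      · exact ⟨0, h0, fun h' => absurd h' h⟩
    choose w hw hw' using hw
    -- The values of `a` on the intersection all have the same sign, so none cancel in this sum.
    set y := ∑ a ∈ hΦ.toFinset, w a with hy
    have hyS : y ∈ ⋂₀ S :=
      Finset.sum_induction _ (· ∈ ⋂₀ S) (fun y z hy hz => hadd y hy z hz) h0 fun a _ => hw a
    have hsgn : ∀ a ∈ Φ, (∀ z ∈ ⋂₀ S, 0 ≤ a ⬝ᵥ z) ∨ ∀ z ∈ ⋂₀ S, a ⬝ᵥ z ≤ 0 := fun a ha => by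
      obtain ⟨c, -, rfl⟩ := hS hC
      rcases le_total 0 (a ⬝ᵥ c) with h | h
      · exact Or.inl fun z hz => (hz _ hC a ha).1 h
      · exact Or.inr fun z hz => (hz _ hC a ha).2 h
    have hmax : ∀ a ∈ Φ, a ⬝ᵥ y = 0 → ∀ z ∈ ⋂₀ S, a ⬝ᵥ z = 0 := fun a ha h0 z hz => by
      by_contra h
      have hne := hw' a ⟨z, hz, h⟩
      rw [hy, dotProduct_sum] at h0
      rcases hsgn a ha with h' | h'
      · exact hne ((Finset.sum_eq_zero_iff_of_nonneg fun b _ => h' _ (hw b)).1 h0 a (by simpa))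
      · exact hne ((Finset.sum_eq_zero_iff_of_nonpos fun b _ => h' _ (hw b)).1 h0 a (by simpa))
    refine ⟨y, Set.Subset.antisymm (fun z hz D hD => ?_) fun z hz a ha => ?_⟩
    · obtain ⟨c, -, rfl⟩ := hS hD
      exact face_subset (hyS _ hD) hz
    · rcases hsgn a ha with h' | h'
      · exact ⟨fun _ => h' z hz, fun h => (hmax a ha (h.antisymm (h' y hyS)) z hz).le⟩
      · exact ⟨fun h => (hmax a ha ((h' y hyS).antisymm h) z hz).ge, fun _ => h' z hz⟩
  · rintro ⟨x, rfl⟩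
    obtain ⟨c, c', hc, hc', h⟩ := exists_generic_inter_eq_face hΦ hu x
    refine ⟨{face Φ c, face Φ c'}, ?_, by simp, by simpa using h⟩
    rw [chambers_image]
    rintro _ (rfl | rfl)
    exacts [⟨c, hc, rfl⟩, ⟨c', hc', rfl⟩]

/-- The span of a face is the intersection of the hyperplanes that contain it. -/
lemma coe_span_face (hΦ : Φ.Finite) (x : Fin n → ℝ) :
    (Submodule.span ℝ (face Φ x) : Set (Fin n → ℝ)) = {z | ∀ a ∈ Φ, a ⬝ᵥ x = 0 → a ⬝ᵥ z = 0} := by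
  refine Set.Subset.antisymm (fun z hz a ha h => ?_) fun z hz => ?_
  · have : Submodule.span ℝ (face Φ x) ≤ hyperplane a := Submodule.span_le.2 fun y hy =>
      ((hy a ha).2 h.le).antisymm ((hy a ha).1 h.ge)
    exact this hz
  · obtain ⟨ε, h0, hε⟩ := exists_small_step hΦ x z
    have hmem : x + ε • z ∈ face Φ x := fun a ha => by
      rw [dotProduct_add, dotProduct_smul, smul_eq_mul]
      by_cases hx : a ⬝ᵥ x = 0
      · simp [hx, hz a ha hx]
      · have := abs_lt.1 (hε a ha hx)
        rcases abs_cases (a ⬝ᵥ x) with h | h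
        · exact ⟨fun _ => by linarith, fun h' => absurd (h.2.lt_of_ne' hx) (by linarith)⟩
        · exact ⟨fun _ => by linarith, fun _ => by linarith⟩
    have hz' : z = ε⁻¹ • ((x + ε • z) - x) := by
      rw [add_sub_cancel_left, smul_smul, inv_mul_cancel₀ h0.ne', one_smul]
    rw [hz']
    exact Submodule.smul_mem _ _ (Submodule.sub_mem _ (Submodule.subset_span hmem)
      (Submodule.subset_span self_mem_face))

/-! ### Simple systems -/

/-- A simple system of the chamber `face Φ c`: vectors `v` in the chamber together with the basis
`a` dual to `v`, which consists of normals of the arrangement up to sign. -/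
structure IsSimpleSystem (Φ : Set (Fin n → ℝ)) (c : Fin n → ℝ) (a v : Fin n → Fin n → ℝ) :
    Prop where
  dual : ∀ i j, a i ⬝ᵥ v j = if i = j then 1 else 0
  mem : ∀ i, a i ∈ Φ ∨ -a i ∈ Φ
  pos : ∀ i, 0 < a i ⬝ᵥ c
  mem_face : ∀ j, v j ∈ face Φ c

namespace IsSimpleSystem

variable {c : Fin n → ℝ} {a v : Fin n → Fin n → ℝ} (h : IsSimpleSystem Φ c a v)
include h

lemma sum_eq (y : Fin n → ℝ) : ∑ i, (a i ⬝ᵥ y) • v i = y := by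
  have h1 : Matrix.of a * (Matrix.of v).transpose = 1 := by
    ext i j
    simp only [Matrix.mul_apply', Matrix.one_apply]
    exact h.dual i j
  have h2 := mul_eq_one_comm.1 h1
  have h3 : (Matrix.of v).transpose.mulVec ((Matrix.of a).mulVec y) = y := by
    rw [Matrix.mulVec_mulVec, h2, Matrix.one_mulVec]
  conv_rhs => rw [← h3]
  ext j
  simp only [Finset.sum_apply, Pi.smul_apply, smul_eq_mul, Matrix.mulVec, dotProduct,
    Matrix.transpose_apply, Matrix.of_apply]
  exact Finset.sum_congr rfl fun i _ => mul_comm _ _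

lemma linearIndependent_normals : LinearIndependent ℝ a := by
  rw [Fintype.linearIndependent_iff]
  intro g hg j
  have : (∑ i, g i • a i) ⬝ᵥ v j = 0 := by rw [hg, zero_dotProduct]
  simpa [sum_dotProduct, h.dual] using this

lemma linearIndependent : LinearIndependent ℝ v := by
  rw [Fintype.linearIndependent_iff]
  intro g hg j
  have : a j ⬝ᵥ (∑ i, g i • v i) = 0 := by rw [hg, dotProduct_zero]
  simpa [dotProduct_sum, h.dual] using this

lemma nonneg {y : Fin n → ℝ} (hy : y ∈ face Φ c) (i : Fin n) : 0 ≤ a i ⬝ᵥ y := by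
  rcases h.mem i with hi | hi
  · exact (hy _ hi).1 (h.pos i).le
  · have := (hy _ hi).2 (by rw [neg_dotProduct]; linarith [h.pos i])
    rw [neg_dotProduct] at this
    linarith

/-- If a normal vanishes at a point of the chamber, it vanishes at the generators that occur in
this point. -/
lemma dot_eq_zero {y b : Fin n → ℝ} (hy : y ∈ face Φ c) (hb : b ∈ Φ) (h0 : b ⬝ᵥ y = 0) {i : Fin n}
    (hi : a i ⬝ᵥ y ≠ 0) : b ⬝ᵥ v i = 0 := by
  rw [← h.sum_eq y, dotProduct_sum] at h0
  simp only [dotProduct_smul, smul_eq_mul] at h0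
  rcases le_total 0 (b ⬝ᵥ c) with hc | hc
  · exact (mul_eq_zero.1 ((Finset.sum_eq_zero_iff_of_nonneg fun j _ =>
      mul_nonneg (h.nonneg hy j) ((h.mem_face j b hb).1 hc)).1 h0 i
      (Finset.mem_univ i))).resolve_left hi
  · exact (mul_eq_zero.1 ((Finset.sum_eq_zero_iff_of_nonpos fun j _ =>
      mul_nonpos_of_nonneg_of_nonpos (h.nonneg hy j) ((h.mem_face j b hb).2 hc)).1 h0 i
      (Finset.mem_univ i))).resolve_left hi

/-- A face contains the generators that occur in one of its interior points. -/
lemma mem_face_of_ne {y : Fin n → ℝ} (hy : y ∈ face Φ c) {i : Fin n} (hi : a i ⬝ᵥ y ≠ 0) :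
    v i ∈ face Φ y := fun b hb => by
  have hyb := hy b hb
  have hvb := h.mem_face i b hb
  by_cases h0 : b ⬝ᵥ y = 0
  · simp [h.dot_eq_zero hy hb h0 hi]
  · refine ⟨fun h1 => hvb.1 ?_, fun h1 => hvb.2 ?_⟩ <;> by_contra! h2
    · exact h0 ((hyb.2 h2.le).antisymm h1)
    · exact h0 (h1.antisymm (hyb.1 h2.le))

lemma mem_face_iff {y z : Fin n → ℝ} (hy : y ∈ face Φ c) :
    z ∈ face Φ y ↔ (∀ i, 0 ≤ a i ⬝ᵥ z) ∧ ∀ i, a i ⬝ᵥ y = 0 → a i ⬝ᵥ z = 0 := by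
  refine ⟨fun hz => ⟨h.nonneg (face_subset hy hz), fun i hi => ?_⟩, fun ⟨h1, h2⟩ => ?_⟩
  · rcases h.mem i with hm | hm
    · exact ((hz _ hm).2 hi.le).antisymm ((hz _ hm).1 hi.ge)
    · have h1 := hz _ hm
      rw [neg_dotProduct, neg_dotProduct, hi] at h1
      simp only [neg_zero, le_refl, true_implies] at h1
      linarith [h1.1, h1.2]
  · rw [← h.sum_eq z]
    refine sum_mem_face fun i _ => ?_
    by_cases hi : a i ⬝ᵥ y = 0
    · rw [h2 i hi, zero_smul]; exact zero_mem_face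
    · exact smul_mem_face (h1 i) (h.mem_face_of_ne hy hi)

lemma mem_face_gen_iff {i j : Fin n} : v i ∈ face Φ (v j) ↔ i = j := by
  refine ⟨fun hi => ?_, fun hij => hij ▸ self_mem_face⟩
  by_contra hij
  have := ((h.mem_face_iff (h.mem_face j)).1 hi).2 i (by rw [h.dual, if_neg hij])
  rw [h.dual, if_pos rfl] at this
  exact one_ne_zero this

lemma span_face {y : Fin n → ℝ} (hy : y ∈ face Φ c) : Submodule.span ℝ (face Φ y)
    = Submodule.span ℝ (v '' {i | a i ⬝ᵥ y ≠ 0}) := by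
  refine le_antisymm (Submodule.span_le.2 fun z hz => ?_) (Submodule.span_mono ?_)
  · rw [← h.sum_eq z]
    refine Submodule.sum_mem _ fun i _ => ?_
    by_cases hi : a i ⬝ᵥ y = 0
    · rw [((h.mem_face_iff hy).1 hz).2 i hi, zero_smul]; exact Submodule.zero_mem _
    · exact Submodule.smul_mem _ _ (Submodule.subset_span ⟨i, hi, rfl⟩)
  · rintro _ ⟨i, hi, rfl⟩
    exact h.mem_face_of_ne hy hi

lemma finrank_span_face {y : Fin n → ℝ} (hy : y ∈ face Φ c) :
    Module.finrank ℝ (Submodule.span ℝ (face Φ y)) = {i | a i ⬝ᵥ y ≠ 0}.ncard := by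
  classical
  rw [h.span_face hy, Set.image_eq_range,
    show (fun i : {i | a i ⬝ᵥ y ≠ 0} => v i) = v ∘ Subtype.val from rfl,
    finrank_span_eq_card (h.linearIndependent.comp _ Subtype.val_injective),
    ← Nat.card_eq_fintype_card, Nat.card_coe_set_eq]

/-- The rays in a face of a chamber are those through the generators occurring in the face. -/
lemma rays_subset_face (hcones : cones (hyperplane '' Φ) = Set.range (face Φ)) {y : Fin n → ℝ}
    (hy : y ∈ face Φ c) : {r | r ∈ rays (hyperplane '' Φ) ∧ r ⊆ face Φ y}
      = (fun i => face Φ (v i)) '' {i | a i ⬝ᵥ y ≠ 0} := by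
  ext r
  constructor
  · rintro ⟨⟨hr, hdim⟩, hsub⟩
    rw [hcones] at hr
    obtain ⟨z, rfl⟩ := hr
    have hzy : z ∈ face Φ y := hsub self_mem_face
    have hz := face_subset hy hzy
    rw [h.finrank_span_face hz, Set.ncard_eq_one] at hdim
    obtain ⟨i, hi⟩ := hdim
    have hi' : i ∈ {i | a i ⬝ᵥ z ≠ 0} := hi ▸ Set.mem_singleton i
    refine ⟨i, fun h0 => hi' (((h.mem_face_iff hy).1 hzy).2 i h0), ?_⟩
    refine face_eq_face_iff.2 ⟨h.mem_face_of_ne hz hi', (h.mem_face_iff (h.mem_face i)).2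
      ⟨h.nonneg hz, fun j hj => ?_⟩⟩
    by_contra h0
    have : j ∈ ({i} : Set (Fin n)) := hi ▸ h0
    rw [Set.mem_singleton_iff.1 this, h.dual, if_pos rfl] at hj
    exact one_ne_zero hj
  · rintro ⟨i, hi, rfl⟩
    refine ⟨⟨hcones ▸ Set.mem_range_self _, ?_⟩, face_subset (h.mem_face_of_ne hy hi)⟩
    rw [h.finrank_span_face (h.mem_face i), Set.ncard_eq_one]
    exact ⟨i, by ext j; simp [h.dual]⟩

lemma encard_rays (hcones : cones (hyperplane '' Φ) = Set.range (face Φ)) {y : Fin n → ℝ}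
    (hy : y ∈ face Φ c) : {r | r ∈ rays (hyperplane '' Φ) ∧ r ⊆ face Φ y}.encard
      = (Module.finrank ℝ (Submodule.span ℝ (face Φ y)) : ℕ∞) := by
  rw [h.rays_subset_face hcones hy, h.finrank_span_face hy, Set.InjOn.encard_image,
    Set.Finite.cast_ncard_eq (Set.toFinite _)]
  intro i _ j _ hij
  exact h.mem_face_gen_iff.1 (face_eq_face_iff.1 hij).1

/-- A face is determined by the rays it contains. -/
lemma mem_face_of_rays (hcones : cones (hyperplane '' Φ) = Set.range (face Φ)) {y z : Fin n → ℝ}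
    (hy : y ∈ face Φ c) (hyz : {r | r ∈ rays (hyperplane '' Φ) ∧ r ⊆ face Φ y}
      ⊆ {r | r ∈ rays (hyperplane '' Φ) ∧ r ⊆ face Φ z}) : y ∈ face Φ z := by
  rw [h.rays_subset_face hcones hy] at hyz
  rw [← h.sum_eq y]
  refine sum_mem_face fun i _ => ?_
  by_cases hi : a i ⬝ᵥ y = 0
  · rw [hi, zero_smul]; exact zero_mem_face
  · exact smul_mem_face (h.nonneg hy i) ((hyz ⟨i, hi, rfl⟩).2 self_mem_face)

/-- The span of a wall lies in a hyperplane `b` of the arrangement that separates two chambers. Some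
generator `v i` is off this hyperplane, so the wall lies in the facet `a i = 0`. -/
lemma wallSpans_subset {H : Submodule ℝ (Fin n → ℝ)}
    (hH : H ∈ wallSpans (hyperplane '' Φ) (face Φ c)) (hc : Generic Φ c) :
    ∃ i, H = hyperplane (a i) := by
  obtain ⟨C', hC', rfl, hdim⟩ := hH
  rw [chambers_image] at hC'
  obtain ⟨c', hc', rfl⟩ := hC'
  have hsep : ∃ b ∈ Φ, ∀ y ∈ face Φ c ∩ face Φ c', b ⬝ᵥ y = 0 := by
    by_contra! hno
    have hcc : face Φ c ⊆ face Φ c' := face_subset fun b hb => by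
      obtain ⟨y, hy, hne⟩ := hno b hb
      have h1 := hy.1 b hb
      have h2 := hy.2 b hb
      refine ⟨fun h0 => ?_, fun h0 => ?_⟩ <;> by_contra! h0'
      · exact hne ((h1.2 h0'.le).antisymm (h2.1 h0))
      · exact hne ((h2.2 h0).antisymm (h1.1 h0'.le))
    rw [Set.inter_eq_left.2 hcc, h.finrank_span_face self_mem_face,
      show {i | a i ⬝ᵥ c ≠ 0} = Set.univ from Set.eq_univ_of_forall fun i => (h.pos i).ne',
      Set.ncard_univ, Nat.card_fin] at hdim
    omega
  obtain ⟨b, hb, hb0⟩ := hsep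
  have hi : ∃ i, b ⬝ᵥ v i ≠ 0 := by
    by_contra! h0
    refine hc b hb ?_
    rw [← h.sum_eq c, dotProduct_sum]
    exact Finset.sum_eq_zero fun i _ => by rw [dotProduct_smul, h0 i, smul_zero]
  obtain ⟨i, hi⟩ := hi
  refine ⟨i, Submodule.eq_of_le_of_finrank_le (Submodule.span_le.2 fun y hy => ?_) ?_⟩
  · by_contra h0
    exact hi (h.dot_eq_zero hy.1 hb (hb0 y hy) h0)
  · have hlt : Module.finrank ℝ (hyperplane (a i)) < Module.finrank ℝ (Fin n → ℝ) := by
      refine Submodule.finrank_lt fun htop => ?_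
      have hv : v i ∈ hyperplane (a i) := htop ▸ Submodule.mem_top
      rw [mem_hyperplane, h.dual, if_pos rfl] at hv
      exact one_ne_zero hv
    rw [Module.finrank_fin_fun] at hlt
    omega

end IsSimpleSystem

/-- Every chamber has a simple system. -/
def HasSimpleSystems (Φ : Set (Fin n → ℝ)) : Prop :=
  ∀ c, Generic Φ c → ∃ a v, IsSimpleSystem Φ c a v

lemma HasSimpleSystems.isSimplicial (hs : HasSimpleSystems Φ) :
    IsSimplicial (hyperplane '' Φ) := by
  intro C hC
  rw [chambers_image] at hC
  obtain ⟨c, hc, rfl⟩ := hC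
  obtain ⟨a, v, h⟩ := hs c hc
  choose f hf using fun H : wallSpans (hyperplane '' Φ) (face Φ c) => h.wallSpans_subset H.2 hc
  refine ⟨fun H => a (f H), hf, h.linearIndependent_normals.comp f fun H H' hH => ?_⟩
  rw [Subtype.ext_iff, hf H, hf H', hH]

/-- The faces of dimension `k`. -/
def facesOfDim (Φ : Set (Fin n → ℝ)) (k : ℕ) : Set (Set (Fin n → ℝ)) :=
  {K | K ∈ Set.range (face Φ) ∧ Module.finrank ℝ (Submodule.span ℝ K) = k}

namespace HasSimpleSystems

variable (hs : HasSimpleSystems Φ) (hΦ : Φ.Finite) {u : Fin n → ℝ} (hu : Generic Φ u)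
include hs hΦ hu

lemma exists_simpleSystem (x : Fin n → ℝ) : ∃ c a v, IsSimpleSystem Φ c a v ∧ x ∈ face Φ c := by
  obtain ⟨c, c', hc, -, h⟩ := exists_generic_inter_eq_face hΦ hu x
  obtain ⟨a, v, hav⟩ := hs c hc
  have hx : x ∈ face Φ c ∩ face Φ c' := h ▸ self_mem_face
  exact ⟨c, a, v, hav, hx.1⟩

lemma encard_rays (x : Fin n → ℝ) : {r | r ∈ rays (hyperplane '' Φ) ∧ r ⊆ face Φ x}.encard
    = (Module.finrank ℝ (Submodule.span ℝ (face Φ x)) : ℕ∞) := by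
  obtain ⟨c, a, v, h, hx⟩ := hs.exists_simpleSystem hΦ hu x
  exact h.encard_rays (cones_image hΦ hu) hx

lemma numFaces_complex (k : ℕ) :
    numFaces (complex (hyperplane '' Φ)) k = (facesOfDim Φ k).ncard := by
  have hset : {σ | σ ∈ complex (hyperplane '' Φ) ∧ σ.encard = k}
      = (fun K => {r | r ∈ rays (hyperplane '' Φ) ∧ r ⊆ K}) '' facesOfDim Φ k := by
    ext σ
    constructor
    · rintro ⟨⟨K, hK, rfl⟩, hk⟩
      rw [cones_image hΦ hu] at hK
      obtain ⟨x, rfl⟩ := hK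
      rw [hs.encard_rays hΦ hu] at hk
      exact ⟨_, ⟨⟨x, rfl⟩, by exact_mod_cast hk⟩, rfl⟩
    · rintro ⟨_, ⟨⟨x, rfl⟩, hk⟩, rfl⟩
      exact ⟨⟨_, cones_image hΦ hu ▸ ⟨x, rfl⟩, rfl⟩, by rw [hs.encard_rays hΦ hu, hk]⟩
  rw [numFaces, hset]
  refine Set.InjOn.ncard_image ?_
  rintro _ ⟨⟨x, rfl⟩, -⟩ _ ⟨⟨y, rfl⟩, -⟩ hxy
  obtain ⟨c, a, v, h, hx⟩ := hs.exists_simpleSystem hΦ hu x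
  obtain ⟨c', a', v', h', hy⟩ := hs.exists_simpleSystem hΦ hu y
  exact face_eq_face_iff.2 ⟨h.mem_face_of_rays (cones_image hΦ hu) hx hxy.subset,
    h'.mem_face_of_rays (cones_image hΦ hu) hy hxy.symm.subset⟩

lemma size_complex : size (complex (hyperplane '' Φ)) = n := by
  refine IsGreatest.csSup_eq ⟨?_, ?_⟩
  · obtain ⟨a, v, h⟩ := hs u hu
    refine ⟨_, ⟨face Φ u, cones_image hΦ hu ▸ Set.mem_range_self u, rfl⟩, ?_⟩
    rw [hs.encard_rays hΦ hu, h.finrank_span_face self_mem_face,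
      show {i | a i ⬝ᵥ u ≠ 0} = Set.univ from Set.eq_univ_of_forall fun i => (h.pos i).ne',
      Set.ncard_univ, Nat.card_fin]
  · rintro k ⟨_, ⟨K, hK, rfl⟩, hk⟩
    rw [cones_image hΦ hu] at hK
    obtain ⟨x, rfl⟩ := hK
    rw [hs.encard_rays hΦ hu] at hk
    rw [← Nat.cast_injective hk]
    simpa using Submodule.finrank_le (Submodule.span ℝ (face Φ x))

lemma hPoly_complex : hPoly (complex (hyperplane '' Φ))
    = ∑ k ∈ Finset.range (n + 1), C ((facesOfDim Φ k).ncard : ℤ) * (X - 1) ^ (n - k) := by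
  rw [hPoly, fPoly, hs.size_complex hΦ hu, ← Finset.sum_range_reflect]
  rw [← coe_compRingHom_apply, map_sum]
  simp only [coe_compRingHom_apply, mul_comp, C_comp, X_pow_comp, hs.numFaces_complex hΦ hu]
  refine Finset.sum_congr rfl fun k hk => ?_
  rw [show n - (n + 1 - 1 - k) = k by have := Finset.mem_range.1 hk; omega, Nat.add_sub_cancel]

end HasSimpleSystems

end Face

/-! ### Faces of the intermediate arrangements -/

section Intermediate

variable {n : ℕ}

/-- The normals of `intermediate n s`. -/
def normals (n s : ℕ) : Set (Fin n → ℝ) :=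
  {a | (∃ i j : Fin n, i < j ∧
      (a = Pi.single i 1 + Pi.single j 1 ∨ a = Pi.single i 1 - Pi.single j 1)) ∨
    ∃ i : Fin n, (i : ℕ) < s ∧ a = Pi.single i 1}

lemma intermediate_eq (n s : ℕ) : intermediate n s = hyperplane '' normals n s := by
  ext H
  constructor
  · rintro (⟨i, j, hij, rfl | rfl⟩ | ⟨i, hi, rfl⟩)
    · exact ⟨_, Or.inl ⟨i, j, hij, Or.inl rfl⟩, rfl⟩
    · exact ⟨_, Or.inl ⟨i, j, hij, Or.inr rfl⟩, rfl⟩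
    · exact ⟨_, Or.inr ⟨i, hi, rfl⟩, rfl⟩
  · rintro ⟨_, ⟨i, j, hij, rfl | rfl⟩ | ⟨i, hi, rfl⟩, rfl⟩
    · exact Or.inl ⟨i, j, hij, Or.inl rfl⟩
    · exact Or.inl ⟨i, j, hij, Or.inr rfl⟩
    · exact Or.inr ⟨i, hi, rfl⟩

lemma finite_normals (n s : ℕ) : (normals n s).Finite := by
  refine Set.Finite.subset ((Set.finite_range fun p : Fin n × Fin n =>
    (Pi.single p.1 1 + Pi.single p.2 1 : Fin n → ℝ)).union
    ((Set.finite_range fun p : Fin n × Fin n =>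
    (Pi.single p.1 1 - Pi.single p.2 1 : Fin n → ℝ)).union
    (Set.finite_range fun i : Fin n => (Pi.single i 1 : Fin n → ℝ)))) ?_
  rintro _ (⟨i, j, -, rfl | rfl⟩ | ⟨i, -, rfl⟩)
  · exact Or.inl ⟨(i, j), rfl⟩
  · exact Or.inr (Or.inl ⟨(i, j), rfl⟩)
  · exact Or.inr (Or.inr ⟨i, rfl⟩)

lemma forall_normals {s : ℕ} {P : (Fin n → ℝ) → Prop} (hneg : ∀ a, P (-a) → P a) :
    (∀ a ∈ normals n s, P a) ↔
      (∀ i j, i ≠ j → P (Pi.single i 1 + Pi.single j 1) ∧ P (Pi.single i 1 - Pi.single j 1)) ∧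
        ∀ i : Fin n, (i : ℕ) < s → P (Pi.single i 1) := by
  refine ⟨fun h => ⟨fun i j hij => ?_, fun i hi => h _ (Or.inr ⟨i, hi, rfl⟩)⟩, fun h => ?_⟩
  · rcases lt_or_gt_of_ne hij with h' | h'
    · exact ⟨h _ (Or.inl ⟨i, j, h', Or.inl rfl⟩), h _ (Or.inl ⟨i, j, h', Or.inr rfl⟩)⟩
    · refine ⟨?_, hneg _ ?_⟩
      · rw [add_comm]; exact h _ (Or.inl ⟨j, i, h', Or.inl rfl⟩)
      · rw [neg_sub]; exact h _ (Or.inl ⟨j, i, h', Or.inr rfl⟩)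
  · rintro _ (⟨i, j, hij, rfl | rfl⟩ | ⟨i, hi, rfl⟩)
    exacts [(h.1 i j hij.ne).1, (h.1 i j hij.ne).2, h.2 i hi]

/-- The sign of `b` is that of `a` or zero. -/
def WeakSign (a b : ℝ) : Prop := (0 ≤ a → 0 ≤ b) ∧ (a ≤ 0 → b ≤ 0)

lemma mem_face_normals {s : ℕ} {x y : Fin n → ℝ} : y ∈ face (normals n s) x ↔
    (∀ i j, i ≠ j → WeakSign (x i + x j) (y i + y j) ∧ WeakSign (x i - x j) (y i - y j)) ∧
      ∀ i : Fin n, (i : ℕ) < s → WeakSign (x i) (y i) := by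
  have := forall_normals (n := n) (s := s) (P := fun a => WeakSign (a ⬝ᵥ x) (a ⬝ᵥ y)) fun a h => by
    simp only [WeakSign, neg_dotProduct, Left.nonneg_neg_iff, Left.neg_nonpos_iff] at h
    exact ⟨h.2, h.1⟩
  change (∀ a ∈ normals n s, WeakSign (a ⬝ᵥ x) (a ⬝ᵥ y)) ↔ _
  simpa [add_dotProduct, sub_dotProduct] using this

lemma generic_normals_iff {s : ℕ} {x : Fin n → ℝ} : Generic (normals n s) x ↔
    (∀ i j, i ≠ j → x i + x j ≠ 0 ∧ x i - x j ≠ 0) ∧ ∀ i : Fin n, (i : ℕ) < s → x i ≠ 0 := by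
  have := forall_normals (n := n) (s := s) (P := fun a => a ⬝ᵥ x ≠ 0) fun a h => by
    simpa using h
  change (∀ a ∈ normals n s, a ⬝ᵥ x ≠ 0) ↔ _
  simpa [add_dotProduct, sub_dotProduct] using this

lemma exists_generic (n s : ℕ) : ∃ u, Generic (normals n s) u := by
  refine ⟨fun i => (i : ℕ) + 1, generic_normals_iff.2 ⟨fun i j hij => ⟨by positivity, fun h => ?_⟩,
    fun i _ => by positivity⟩⟩
  have : ((i : ℕ) : ℝ) = (j : ℕ) := by linarith
  exact hij (Fin.ext (by exact_mod_cast this))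

/-- A sufficient condition for membership in a face. No condition is needed on the sign of a
coordinate outside the first `s` that is the only one of minimal absolute value. -/
lemma mem_face_normals_of {s : ℕ} {x y : Fin n → ℝ}
    (habs : ∀ i j, i ≠ j → |x i| ≤ |x j| → |y i| ≤ |y j|)
    (hsign : ∀ i : Fin n, ((i : ℕ) < s ∨ ∃ j, j ≠ i ∧ |x j| ≤ |x i|) → WeakSign (x i) (y i)) :
    y ∈ face (normals n s) x := by
  have key (i j : Fin n) (hij : i ≠ j) (h : |x i| ≤ |x j|) :
      WeakSign (x i + x j) (y i + y j) ∧ WeakSign (x i - x j) (y i - y j) := by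
    have hj := hsign j (Or.inr ⟨i, hij, h⟩)
    have hy := abs_le.1 (habs i j hij h)
    rcases h.lt_or_eq with hlt | heq
    · have := abs_lt.1 hlt
      rcases abs_cases (x j) with h1 | h1 <;> rcases abs_cases (y j) with h2 | h2 <;>
        refine ⟨⟨fun h3 => ?_, fun h3 => ?_⟩, ⟨fun h3 => ?_, fun h3 => ?_⟩⟩ <;>
        first
          | linarith
          | (have := hj.1 (by linarith); linarith)
          | (have := hj.2 (by linarith); linarith)
    · have hi := hsign i (Or.inr ⟨j, hij.symm, heq.ge⟩)
      have hy' := abs_le.1 (habs j i hij.symm heq.ge)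
      rcases abs_cases (y i) with h4 | h4 <;> rcases abs_cases (y j) with h2 | h2 <;>
        rcases abs_eq_abs.1 heq with h1 | h1 <;> rw [h1] at hi ⊢ <;>
        rcases le_total 0 (x j) with h0 | h0 <;>
        refine ⟨⟨fun h3 => ?_, fun h3 => ?_⟩, ⟨fun h3 => ?_, fun h3 => ?_⟩⟩ <;>
        first
          | linarith
          | (have := hj.1 (by linarith); have := hi.1 (by linarith); linarith)
          | (have := hj.2 (by linarith); have := hi.2 (by linarith); linarith)
          | (have := hj.1 (by linarith); have := hi.2 (by linarith); linarith)
          | (have := hj.2 (by linarith); have := hi.1 (by linarith); linarith)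
  refine mem_face_normals.2 ⟨fun i j hij => ?_, fun i hi => hsign i (Or.inl hi)⟩
  rcases le_total |x i| |x j| with h | h
  · exact key i j hij h
  · have := key j i hij.symm h
    rw [add_comm (x i), add_comm (y i), ← neg_sub (x j), ← neg_sub (y j)]
    refine ⟨this.1, ?_⟩
    simpa only [WeakSign, Left.nonneg_neg_iff, Left.neg_nonpos_iff] using this.2.symm

lemma single_add_single_mem {s : ℕ} {i j : Fin n} (hij : i ≠ j) {p q : ℝ} (hp : p = 1 ∨ p = -1)
    (hq : q = 1 ∨ q = -1) : Pi.single i p + Pi.single j q ∈ normals n s ∨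
      -(Pi.single i p + Pi.single j q : Fin n → ℝ) ∈ normals n s := by
  wlog h : i < j generalizing i j p q
  · rw [add_comm]
    exact this hij.symm hq hp (lt_of_le_of_ne (not_lt.1 h) hij.symm)
  rcases hp with rfl | rfl <;> rcases hq with rfl | rfl
  · exact Or.inl (Or.inl ⟨i, j, h, Or.inl rfl⟩)
  · exact Or.inl (Or.inl ⟨i, j, h, Or.inr (by rw [Pi.single_neg, sub_eq_add_neg])⟩)
  · exact Or.inr (Or.inl ⟨i, j, h, Or.inr (by rw [Pi.single_neg]; abel)⟩)
  · exact Or.inr (Or.inl ⟨i, j, h, Or.inl (by rw [Pi.single_neg, Pi.single_neg]; abel)⟩)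

/-- The simple systems. If `|x₀| < |x₁| < ⋯` after a permutation of the coordinates, then up to
signs the simple normals are `e_{k+1} - e_k` together with `e₀` if the coordinate of least absolute
value is among the first `s`, and with `e₀ + e₁` otherwise. -/
lemma hasSimpleSystems_normals {s : ℕ} (hn : 2 ≤ n ∨ n = s) : HasSimpleSystems (normals n s) := by
  intro c hc
  obtain _ | N := n
  · exact ⟨0, 0, ⟨fun i => i.elim0, fun i => i.elim0, fun i => i.elim0, fun i => i.elim0⟩⟩
  obtain ⟨hc1, hc2⟩ := generic_normals_iff.1 hc
  set σ := Tuple.sort fun i => |c i| with hσ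
  have hinj : Function.Injective fun i => |c (σ i)| := fun i j h => by
    by_contra hij
    have := hc1 _ _ (σ.injective.ne hij)
    rcases abs_eq_abs.1 h with h | h
    · exact this.2 (by linarith)
    · exact this.1 (by linarith)
  have hmono : StrictMono fun i => |c (σ i)| :=
    (Tuple.monotone_sort fun i => |c i|).strictMono_of_injective hinj
  have hpos (k : Fin N) : 0 < |c (σ k.succ)| :=
    (abs_nonneg _).trans_lt (hmono (Fin.castSucc_lt_succ (i := k)))
  have hsurj {P : Fin (N + 1) → Prop} (h : ∀ k, P (σ k)) (i : Fin (N + 1)) : P i := by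
    simpa using h (σ.symm i)
  -- The sign of a vanishing coordinate is set to `1`.
  set e : Fin (N + 1) → ℝ := fun k => if c (σ k) < 0 then -1 else 1 with he
  have he1 (k) : e k = 1 ∨ e k = -1 := by simp only [he]; split_ifs <;> simp
  have he2 (k) : e k * e k = 1 := by rcases he1 k with h | h <;> rw [h] <;> norm_num
  have he3 (k) : |e k| = 1 := by rcases he1 k with h | h <;> rw [h] <;> simp
  have he4 (k) : e k * c (σ k) = |c (σ k)| := by
    simp only [he]
    split_ifs with h
    · rw [abs_of_neg h]; ring
    · rw [abs_of_nonneg (not_lt.1 h)]; ring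
  have hwe (k) (t : ℝ) (ht : 0 ≤ t) (h0 : c (σ k) ≠ 0) : WeakSign (c (σ k)) (t * e k) := by
    simp only [he]
    split_ifs with h
    · exact ⟨fun h' => absurd h h'.not_gt, fun _ => by linarith⟩
    · exact ⟨fun _ => by linarith, fun h' => absurd (h'.antisymm (not_lt.1 h)) h0⟩
  set f : Fin (N + 1) → Fin (N + 1) → ℝ := fun k => Pi.single (σ k) (e k) with hf
  set w : Fin (N + 1) → Fin (N + 1) → ℝ :=
    fun k i => if k ≤ σ.symm i then e (σ.symm i) else 0 with hw
  have hfc (k) : f k ⬝ᵥ c = |c (σ k)| := by simp [hf, he4]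
  have hfw (k l) : f k ⬝ᵥ w l = if l ≤ k then 1 else 0 := by
    simp only [hf, hw, single_dotProduct, Equiv.symm_apply_apply]
    split_ifs <;> simp [he2]
  have hwσ (k l) : w k (σ l) = if k ≤ l then e l else 0 := by simp [hw]
  have hwmem (k) (hk : k ≠ 0 ∨ c (σ 0) ≠ 0) : w k ∈ face (normals (N + 1) s) c := by
    refine mem_face_normals_of (hsurj fun i => hsurj fun j => ?_) (hsurj fun i => ?_)
    · intro hij h
      rw [hwσ, hwσ]
      have : i ≤ j := hmono.le_iff_le.1 h
      split_ifs with h1 h2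
      · rw [he3, he3]
      · exact absurd (h1.trans this) h2
      · simp
      · simp
    · intro _
      rw [hwσ]
      split_ifs with h
      · rw [← one_mul (e i)]
        refine hwe i 1 zero_le_one ?_
        induction i using Fin.cases with
        | zero => exact hk.resolve_left fun h' => h' (Fin.le_zero_iff.1 h)
        | succ i => exact abs_pos.1 (hpos i)
      · exact ⟨fun _ => le_rfl, fun _ => le_rfl⟩
  have hdiffmem (k : Fin N) : f k.succ - f k.castSucc ∈ normals (N + 1) s ∨
      -(f k.succ - f k.castSucc) ∈ normals (N + 1) s := by
    have := single_add_single_mem (s := s) (σ.injective.ne (Fin.castSucc_lt_succ (i := k)).ne')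
      (he1 k.succ) (q := -e k.castSucc) (by rcases he1 k.castSucc with h | h <;> rw [h] <;> simp)
    rwa [Pi.single_neg, ← sub_eq_add_neg] at this
  have hdiffpos (k : Fin N) : 0 < (f k.succ - f k.castSucc) ⬝ᵥ c := by
    rw [sub_dotProduct, hfc, hfc]
    exact sub_pos.2 (hmono (Fin.castSucc_lt_succ (i := k)))
  have hdiffw (k : Fin N) (l) : (f k.succ - f k.castSucc) ⬝ᵥ w l = if k.succ = l then 1 else 0 := by
    rw [sub_dotProduct, hfw, hfw]
    simp only [Fin.le_def, Fin.ext_iff, Fin.val_succ, Fin.val_castSucc]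
    split_ifs <;> first | omega | simp
  by_cases hs : (σ 0 : ℕ) < s
  · have h0 := hc2 _ hs
    refine ⟨Fin.cases (f 0) fun k => f k.succ - f k.castSucc, w, ?_, ?_, ?_, fun k =>
      hwmem k (Or.inr h0)⟩
    · intro i j
      induction i using Fin.cases with
      | zero =>
        simp only [Fin.cases_zero, hfw, Fin.le_zero_iff, eq_comm]
      | succ i => exact hdiffw i j
    · intro i
      induction i using Fin.cases with
      | zero =>
        rcases he1 0 with h | h
        · exact Or.inl (Or.inr ⟨σ 0, hs, by simp [hf, h]⟩)
        · exact Or.inr (Or.inr ⟨σ 0, hs, by simp [hf, h, Pi.single_neg]⟩)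
      | succ i => exact hdiffmem i
    · intro i
      induction i using Fin.cases with
      | zero => simpa only [Fin.cases_zero, hfc] using abs_pos.2 h0
      | succ i => exact hdiffpos i
  · obtain _ | N := N
    · have := (σ 0).2
      omega
    have h10 : (1 : Fin (N + 2)) = (0 : Fin (N + 1)).succ := rfl
    have h01 : (0 : Fin (N + 2)) ≠ 1 := by simp
    -- In this case the coordinate `σ 0` imposes no sign condition on points of the chamber.
    have hhalf (y : Fin (N + 2) → ℝ) (hy0 : |y (σ 0)| = 1 / 2)
        (hy : ∀ k, k ≠ 0 → y (σ k) = 1 / 2 * e k) : y ∈ face (normals (N + 2) s) c := by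
      have hyabs : ∀ i, |y i| = 1 / 2 := hsurj fun k => by
        by_cases hk : k = 0
        · rw [hk, hy0]
        · rw [hy k hk, abs_mul, he3]; norm_num
      refine mem_face_normals_of (fun i j _ _ => by rw [hyabs, hyabs]) (hsurj fun k => ?_)
      induction k using Fin.cases with
      | zero =>
        rintro (h | ⟨j, hj, h⟩)
        · exact absurd h hs
        · refine absurd (hmono.le_iff_le (a := σ.symm j) (b := 0).1 (by simpa using h)) fun h' => ?_
          exact hj (by rw [← Fin.le_zero_iff.1 h']; simp)
      | succ k =>
        intro _
        rw [hy _ (Fin.succ_ne_zero k)]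
        exact hwe _ _ (by norm_num) (abs_pos.1 (hpos k))
    refine ⟨Fin.cases (f 0 + f 1) fun k => f k.succ - f k.castSucc,
      fun k => if k = 0 then (1 / 2 : ℝ) • w 0 else if k = 1 then w 1 - (1 / 2 : ℝ) • w 0 else w k,
      ?_, ?_, ?_, ?_⟩
    · intro i j
      induction i using Fin.cases with
      | zero =>
        simp only [Fin.cases_zero]
        split_ifs with h1 h2 h2 h3 h3
        · subst h1
          rw [dotProduct_smul, add_dotProduct, hfw, hfw]; norm_num
        · exact absurd h1.symm h2
        · exact absurd h3.symm h1
        · rw [dotProduct_sub, dotProduct_smul, add_dotProduct, add_dotProduct, hfw, hfw, hfw, hfw]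
          norm_num
        · exact absurd h3.symm h1
        · rw [add_dotProduct, hfw, hfw, if_neg, if_neg]
          · norm_num
          · have h0 : 0 < (j : ℕ) := Fin.pos_iff_ne_zero.2 h1
            have h2' : (j : ℕ) ≠ 1 := fun h => h2 (Fin.ext h)
            rw [Fin.le_def]
            change ¬(j : ℕ) ≤ 1
            omega
          · rwa [Fin.le_zero_iff]
      | succ i =>
        simp only [Fin.cases_succ]
        split_ifs with h1 h2 h2 h3 h3
        · rw [h1] at h2; exact absurd h2 (Fin.succ_ne_zero i)
        · rw [dotProduct_smul, hdiffw, if_neg (Fin.succ_ne_zero i), smul_zero]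
        · rw [dotProduct_sub, dotProduct_smul, hdiffw, hdiffw, if_neg (Fin.succ_ne_zero i), if_pos]
          · simp
          · rw [h3, h2]
        · rw [dotProduct_sub, dotProduct_smul, hdiffw, hdiffw, if_neg (Fin.succ_ne_zero i), if_neg]
          · simp
          · rw [← h2]; assumption
        · rw [hdiffw, if_pos h3]
        · rw [hdiffw, if_neg h3]
    · intro i
      induction i using Fin.cases with
      | zero => exact single_add_single_mem (σ.injective.ne h01) (he1 0) (he1 1)
      | succ i => exact hdiffmem i
    · intro i
      induction i using Fin.cases with
      | zero =>
        simp only [Fin.cases_zero, add_dotProduct, hfc]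
        have := hpos 0
        rw [← h10] at this
        have := abs_nonneg (c (σ 0))
        linarith
      | succ i => exact hdiffpos i
    · intro k
      split_ifs with h1 h2
      · refine hhalf _ ?_ fun k _ => ?_
        · simp [hwσ, abs_mul, he3]
        · simp [hwσ]
      · refine hhalf _ ?_ fun k hk => ?_
        · simp [hwσ, abs_mul, he3]
        · have : 1 ≤ k := Fin.one_le_of_ne_zero hk
          simp [hwσ, this]; ring
      · exact hwmem k (Or.inl h1)

/-- A condition that singles out points of each face that have the same signs of coordinates and the
same order of their absolute values: a coordinate outside the first `s` that is the only one of
minimal absolute value has to be positive. -/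
def Normalized (s : ℕ) (x : Fin n → ℝ) : Prop :=
  ∀ i : Fin n, s ≤ i → (∀ j, j ≠ i → |x i| < |x j|) → 0 < x i

lemma exists_normalized (s : ℕ) (x : Fin n → ℝ) :
    ∃ y, Normalized s y ∧ face (normals n s) y = face (normals n s) x := by
  by_cases h : ∃ i : Fin n, s ≤ i ∧ ∀ j, j ≠ i → |x i| < |x j|
  · obtain ⟨i, hi, hmin⟩ := h
    obtain ⟨t, ht0, ht⟩ : ∃ t : ℝ, 0 < t ∧ ∀ j, j ≠ i → t < |x j| := by
      have : ∀ᶠ t : ℝ in nhdsWithin 0 (Set.Ioi 0), ∀ j, j ≠ i → t < |x j| := by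
        rw [Filter.eventually_all]
        intro j
        rw [Filter.eventually_imp_distrib_left]
        intro hj
        exact (eventually_lt_nhds ((abs_nonneg _).trans_lt (hmin j hj))).filter_mono
          nhdsWithin_le_nhds
      obtain ⟨t, h1, h2⟩ := (this.and self_mem_nhdsWithin).exists
      exact ⟨t, h2, h1⟩
    have hti : |Function.update x i t i| = t := by rw [Function.update_self, abs_of_pos ht0]
    have hkey {y z : Fin n → ℝ} (hyz : ∀ j, j ≠ i → y j = z j) (hy : ∀ j, j ≠ i → |y i| < |y j|)
        (hz : ∀ j, j ≠ i → |z i| < |z j|) : z ∈ face (normals n s) y := by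
      refine mem_face_normals_of (fun j k hjk h => ?_) fun j hj => ?_
      · by_cases hji : j = i
        · subst hji; exact (hz k hjk.symm).le
        · by_cases hki : k = i
          · subst hki; exact absurd h (hy j hji).not_ge
          · rwa [hyz j hji, hyz k hki] at h
      · by_cases hji : j = i
        · subst hji
          rcases hj with h | ⟨k, hk, h⟩
          · exact absurd h hi.not_gt
          · exact absurd h (hy k hk).not_ge
        · rw [hyz j hji]; exact ⟨id, id⟩
    have hup : ∀ j, j ≠ i → Function.update x i t j = x j := fun j hj =>
      Function.update_of_ne hj _ _
    have hmin' : ∀ j, j ≠ i → |Function.update x i t i| < |Function.update x i t j| :=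
      fun j hj => by rw [hti, hup j hj]; exact ht j hj
    refine ⟨Function.update x i t, fun j hj hj' => ?_, face_eq_face_iff.2 ⟨?_, ?_⟩⟩
    · by_cases hji : j = i
      · rw [hji, Function.update_self]; exact ht0
      · exact absurd (hj' i (Ne.symm hji)) (hmin' j hji).not_gt
    · exact hkey (fun j hj => (hup j hj).symm) hmin hmin'
    · exact hkey hup hmin' hmin
  · exact ⟨x, fun i hi hmin => absurd ⟨i, hi, hmin⟩ h, rfl⟩

/-- The points `x` and `y` have the same signs of coordinates and the same order of the absolute
values of their coordinates. -/
def SameType (x y : Fin n → ℝ) : Prop :=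
  (∀ i, SignType.sign (x i) = SignType.sign (y i)) ∧ ∀ i j, |x i| ≤ |x j| ↔ |y i| ≤ |y j|

lemma SameType.symm {x y : Fin n → ℝ} (h : SameType x y) : SameType y x :=
  ⟨fun i => (h.1 i).symm, fun i j => (h.2 i j).symm⟩

lemma sign_eq_of_weakSign {a b : ℝ} (h : WeakSign a b) (h' : WeakSign b a) :
    SignType.sign a = SignType.sign b := by
  rcases lt_trichotomy a 0 with ha | rfl | ha
  · rw [sign_neg ha, sign_neg]
    by_contra! hb
    exact absurd (h'.1 hb) ha.not_ge
  · rw [(h.2 le_rfl).antisymm (h.1 le_rfl)]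
  · rw [sign_pos ha, sign_pos]
    by_contra! hb
    exact absurd (h'.2 hb) ha.not_ge

lemma weakSign_of_sign_eq {a b : ℝ} (h : SignType.sign a = SignType.sign b) : WeakSign a b :=
  ⟨fun ha => sign_nonneg_iff.1 (h ▸ sign_nonneg_iff.2 ha),
    fun ha => sign_nonpos_iff.1 (h ▸ sign_nonpos_iff.2 ha)⟩

lemma SameType.mem_face {s : ℕ} {x y : Fin n → ℝ} (h : SameType x y) :
    y ∈ face (normals n s) x :=
  mem_face_normals_of (fun i j _ => (h.2 i j).1) fun i _ => weakSign_of_sign_eq (h.1 i)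

lemma SameType.normalized {s : ℕ} {x y : Fin n → ℝ} (h : SameType x y) (hx : Normalized s x) :
    Normalized s y := fun i hi hmin => by
  rw [← sign_eq_one_iff, ← h.1 i, sign_eq_one_iff]
  exact hx i hi fun j hj => lt_of_not_ge fun hle => (hmin j hj).not_ge ((h.2 j i).1 hle)

lemma face_eq_iff_sameType {s : ℕ} {x y : Fin n → ℝ} (hx : Normalized s x) (hy : Normalized s y) :
    face (normals n s) x = face (normals n s) y ↔ SameType x y := by
  refine ⟨fun h => ?_, fun h => face_eq_face_iff.2 ⟨h.symm.mem_face, h.mem_face⟩⟩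
  obtain ⟨h1, h2⟩ := face_eq_face_iff.1 h
  rw [mem_face_normals] at h1 h2
  have hadd (i j) (hij : i ≠ j) : SignType.sign (x i + x j) = SignType.sign (y i + y j) :=
    sign_eq_of_weakSign (h2.1 i j hij).1 (h1.1 i j hij).1
  have hsub (i j) (hij : i ≠ j) : SignType.sign (x i - x j) = SignType.sign (y i - y j) :=
    sign_eq_of_weakSign (h2.1 i j hij).2 (h1.1 i j hij).2
  have habs (i j) : |x i| ≤ |x j| ↔ |y i| ≤ |y j| := by
    by_cases hij : i = j
    · simp [hij]
    have hfac (z : Fin n → ℝ) : |z i| ≤ |z j| ↔ SignType.sign (z i + z j) *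
        SignType.sign (z i - z j) ≤ 0 := by
      rw [← sign_mul, sign_nonpos_iff, ← sq_le_sq,
        show (z i + z j) * (z i - z j) = z i ^ 2 - z j ^ 2 by ring, sub_nonpos]
    rw [hfac, hfac, hadd i j hij, hsub i j hij]
  refine ⟨fun i => ?_, habs⟩
  by_cases hi : (i : ℕ) < s
  · exact sign_eq_of_weakSign (h2.2 i hi) (h1.2 i hi)
  by_cases hmin : ∀ j, j ≠ i → |x i| < |x j|
  · rw [sign_pos (hx i (not_lt.1 hi) hmin), sign_pos (hy i (not_lt.1 hi) fun j hj => ?_)]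
    exact lt_of_not_ge fun hle => (hmin j hj).not_ge ((habs j i).2 hle)
  · push Not at hmin
    obtain ⟨j, hj, hle⟩ := hmin
    have hle' := (habs j i).1 hle
    -- The larger of two coordinates in absolute value dominates their sum and difference.
    have hws {x y : Fin n → ℝ} (hle : |x j| ≤ |x i|) (ha : WeakSign (x i + x j) (y i + y j))
        (hs : WeakSign (x i - x j) (y i - y j)) : WeakSign (x i) (y i) := by
      have h' := abs_le.1 hle
      refine ⟨fun h0 => ?_, fun h0 => ?_⟩
      · rw [abs_of_nonneg h0] at h'
        linarith [ha.1 (by linarith), hs.1 (by linarith)]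
      · rw [abs_of_nonpos h0] at h'
        linarith [ha.2 (by linarith), hs.2 (by linarith)]
    exact sign_eq_of_weakSign (hws hle (h2.1 i j hj.symm).1 (h2.1 i j hj.symm).2)
      (hws hle' (h1.1 i j hj.symm).1 (h1.1 i j hj.symm).2)

/-- The nonzero absolute values of the coordinates of `x`. -/
noncomputable def levels (x : Fin n → ℝ) : Finset ℝ := (Finset.univ.image fun i => |x i|).erase 0

lemma mem_levels {x : Fin n → ℝ} {t : ℝ} : t ∈ levels x ↔ t ≠ 0 ∧ ∃ i, |x i| = t := by
  simp [levels]

lemma abs_mem_levels {x : Fin n → ℝ} {i : Fin n} (hi : x i ≠ 0) : |x i| ∈ levels x :=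
  mem_levels.2 ⟨abs_ne_zero.2 hi, i, rfl⟩

/-- The map from functions of the levels to points whose coordinates depend only on the levels of
`x` and have the signs of those of `x`. -/
noncomputable def levelMap (x : Fin n → ℝ) : (levels x → ℝ) →ₗ[ℝ] (Fin n → ℝ) where
  toFun g i := if h : x i ≠ 0 then SignType.sign (x i) * g ⟨|x i|, abs_mem_levels h⟩ else 0
  map_add' g g' := by ext i; by_cases h : x i = 0 <;> simp [h, mul_add]
  map_smul' c g := by ext i; by_cases h : x i = 0 <;> simp [h]; ring

lemma levelMap_apply {x : Fin n → ℝ} (g : levels x → ℝ) {i : Fin n} (h : x i ≠ 0) :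
    levelMap x g i = SignType.sign (x i) * g ⟨|x i|, abs_mem_levels h⟩ := dif_pos h

lemma levelMap_apply_zero {x : Fin n → ℝ} (g : levels x → ℝ) {i : Fin n} (h : x i = 0) :
    levelMap x g i = 0 := dif_neg (by simpa using h)

lemma sign_mul_sign {t : ℝ} (h : t ≠ 0) : ((SignType.sign t : ℝ)) * (SignType.sign t : ℝ) = 1 := by
  rcases lt_or_gt_of_ne h with h | h
  · simp [sign_neg h]
  · simp [sign_pos h]

lemma range_levelMap {s : ℕ} {x : Fin n → ℝ} (hx : Normalized s x) :
    LinearMap.range (levelMap x) = Submodule.span ℝ (face (normals n s) x) := by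
  have hflat (z : Fin n → ℝ) : z ∈ Submodule.span ℝ (face (normals n s) x) ↔
      (∀ i j, i ≠ j → (x i + x j = 0 → z i + z j = 0) ∧ (x i - x j = 0 → z i - z j = 0)) ∧
        ∀ i : Fin n, (i : ℕ) < s → x i = 0 → z i = 0 := by
    rw [← SetLike.mem_coe, coe_span_face (finite_normals n s)]
    have := forall_normals (n := n) (s := s) (P := fun a => a ⬝ᵥ x = 0 → a ⬝ᵥ z = 0) fun a h => by
      simpa using h
    simpa [add_dotProduct, sub_dotProduct] using this
  ext z
  rw [hflat]
  constructor
  · rintro ⟨g, rfl⟩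
    refine ⟨fun i j _ => ⟨fun h => ?_, fun h => ?_⟩, fun i _ h => levelMap_apply_zero g h⟩
    · have h' : x i = -x j := by linarith
      by_cases h0 : x j = 0
      · rw [levelMap_apply_zero g h0, levelMap_apply_zero g (by rw [h', h0, neg_zero]), add_zero]
      · rw [levelMap_apply g h0, levelMap_apply g (by rw [h']; exact neg_ne_zero.2 h0)]
        simp only [h', abs_neg, Left.sign_neg, SignType.coe_neg]
        ring
    · have h' : x i = x j := by linarith
      by_cases h0 : x j = 0
      · rw [levelMap_apply_zero g h0, levelMap_apply_zero g (by rw [h', h0]), sub_zero]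
      · rw [levelMap_apply g h0, levelMap_apply g (by rwa [h'])]
        simp only [h', sub_self]
  · rintro ⟨h1, h2⟩
    choose p hp using fun t : levels x => (mem_levels.1 t.2).2
    refine ⟨fun t => SignType.sign (x (p t)) * z (p t), ?_⟩
    ext i
    by_cases hi : x i = 0
    · rw [levelMap_apply_zero _ hi]
      by_cases hs : (i : ℕ) < s
      · exact (h2 i hs hi).symm
      · -- A zero coordinate outside the first `s` is accompanied by another zero coordinate.
        have : ∃ j, j ≠ i ∧ |x j| ≤ |x i| := by
          by_contra! hmin
          exact (hx i (not_lt.1 hs) hmin).ne' hi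
        obtain ⟨j, hj, hle⟩ := this
        have hj0 : x j = 0 := by simpa [hi] using hle
        have := h1 i j hj.symm
        linarith [this.1 (by rw [hi, hj0, add_zero]), this.2 (by rw [hi, hj0, sub_zero])]
    · rw [levelMap_apply _ hi]
      have hpi := hp ⟨|x i|, abs_mem_levels hi⟩
      set j := p ⟨|x i|, abs_mem_levels hi⟩
      by_cases hij : i = j
      · rw [← hij, ← mul_assoc, sign_mul_sign hi, one_mul]
      rcases abs_eq_abs.1 hpi with h | h
      · have := (h1 i j hij).2 (by linarith)
        rw [h, ← mul_assoc, sign_mul_sign hi, one_mul]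
        linarith
      · have := (h1 i j hij).1 (by linarith)
        rw [h, Left.sign_neg, SignType.coe_neg, neg_mul, mul_neg, ← mul_assoc, sign_mul_sign hi]
        linarith

/-- The dimension of a face is the number of levels of a normalized point in its interior. -/
lemma finrank_span_face_normals {s : ℕ} {x : Fin n → ℝ} (hx : Normalized s x) :
    Module.finrank ℝ (Submodule.span ℝ (face (normals n s) x)) = (levels x).card := by
  have hinj : Function.Injective (levelMap x) := by
    rw [← LinearMap.ker_eq_bot, LinearMap.ker_eq_bot']
    intro g hg
    ext ⟨t, ht⟩
    obtain ⟨h0, i, rfl⟩ := mem_levels.1 ht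
    have hi : x i ≠ 0 := by simpa using h0
    have := congrFun hg i
    rw [levelMap_apply g hi] at this
    exact (mul_eq_zero.1 this).resolve_left (left_ne_zero_of_mul_eq_one (sign_mul_sign hi))
  rw [← range_levelMap hx, LinearMap.finrank_range_of_inj hinj, Module.finrank_fintype_fun_eq_card,
    Fintype.card_coe]

end Intermediate

/-! ### Binomial expansions and the resulting polynomials -/

/-- The coefficients of `(2m + c)ⁿ` in the basis `m.choose k`, see `sum_binomCoeff`. -/
def binomCoeff (c : ℤ) : ℕ → ℕ → ℤ
  | 0, 0 => 1
  | 0, _ + 1 => 0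
  | n + 1, 0 => c * binomCoeff c n 0
  | n + 1, k + 1 => (2 * (k + 1) + c) * binomCoeff c n (k + 1) + 2 * (k + 1) * binomCoeff c n k

lemma binomCoeff_eq_zero (c : ℤ) {n k : ℕ} (h : n < k) : binomCoeff c n k = 0 := by
  induction n generalizing k with
  | zero => obtain _ | k := k <;> simp_all [binomCoeff]
  | succ n ih =>
    obtain _ | k := k
    · simp at h
    · rw [binomCoeff, ih (by omega), ih (by omega)]; simp

lemma sum_binomCoeff (c : ℤ) (n m : ℕ) :
    ∑ k ∈ Finset.range (n + 1), binomCoeff c n k * (m.choose k : ℤ) = (2 * m + c) ^ n := by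
  induction n with
  | zero => simp [binomCoeff]
  | succ n ih =>
    have key (k : ℕ) : (2 * (m : ℤ) + c) * m.choose k
        = (2 * k + c) * m.choose k + 2 * (k + 1) * m.choose (k + 1) := by
      have h := Nat.choose_succ_right_eq m k
      rcases le_or_gt k m with hk | hk
      · zify [hk] at h
        linear_combination -2 * h
      · simp [Nat.choose_eq_zero_of_lt hk, Nat.choose_eq_zero_of_lt (Nat.lt_succ_of_lt hk)]
    have h1 : ∑ k ∈ Finset.range (n + 1), (2 * (k : ℤ) + c) * binomCoeff c n k * m.choose k
        = ∑ k ∈ Finset.range (n + 2), (2 * (k : ℤ) + c) * binomCoeff c n k * m.choose k := by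
      rw [Finset.sum_range_succ _ (n + 1), binomCoeff_eq_zero c (Nat.lt_succ_self n)]; simp
    rw [pow_succ, ← ih, Finset.sum_mul]
    have h2 : ∑ k ∈ Finset.range (n + 1), binomCoeff c n k * (m.choose k : ℤ) * (2 * m + c)
        = ∑ k ∈ Finset.range (n + 1), (2 * (k : ℤ) + c) * binomCoeff c n k * m.choose k
          + ∑ k ∈ Finset.range (n + 1),
            2 * ((k : ℤ) + 1) * binomCoeff c n k * m.choose (k + 1) := by
      rw [← Finset.sum_add_distrib]
      exact Finset.sum_congr rfl fun k _ => by linear_combination binomCoeff c n k * key k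
    rw [h2, h1, Finset.sum_range_succ' _ (n + 1), Finset.sum_range_succ' _ (n + 1)]
    simp only [binomCoeff, add_mul, Finset.sum_add_distrib]
    push_cast
    ring

/-- Coefficients in the basis `m.choose k` are unique. -/
lemma eq_of_sum_choose_eq {N : ℕ} {f g : ℕ → ℤ}
    (h : ∀ m : ℕ, ∑ k ∈ Finset.range N, f k * (m.choose k : ℤ)
      = ∑ k ∈ Finset.range N, g k * (m.choose k : ℤ)) {k : ℕ} (hk : k < N) : f k = g k := by
  induction k using Nat.strong_induction_on with
  | _ k ih =>
    have h1 := h k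
    have hsplit (f : ℕ → ℤ) : ∑ l ∈ Finset.range N, f l * (k.choose l : ℤ)
        = ∑ l ∈ Finset.range (k + 1), f l * (k.choose l : ℤ) := by
      refine (Finset.sum_subset (Finset.range_subset_range.2 hk) fun l _ hl => ?_).symm
      rw [Nat.choose_eq_zero_of_lt (by simpa using hl)]; simp
    rw [hsplit, hsplit, Finset.sum_range_succ, Finset.sum_range_succ,
      Finset.sum_congr rfl fun l hl => by
        rw [ih l (Finset.mem_range.1 hl) ((Finset.mem_range.1 hl).trans hk)]] at h1
    simpa using h1

/-- The polynomial with the coefficients `binomCoeff c n k` as `f`-vector, in the form in which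
the `h`-polynomial is defined. For `c = 1` this is the Eulerian polynomial of type `B`, for `c = 0`
it is `2ⁿ` times the Eulerian polynomial of type `A`. -/
noncomputable def eulerianPoly (c : ℤ) (n : ℕ) : ℤ[X] :=
  ∑ k ∈ Finset.range (n + 1), C (binomCoeff c n k) * (X - 1) ^ (n - k)

/-- The recursion of the polynomials `eulerianPoly`, with `r = 2 - c` and `D = n + 1 - r`. -/
noncomputable def eulerianStep (D r : ℤ) (P : ℤ[X]) : ℤ[X] :=
  (C (2 * D + r) * X + C r) * P + 2 * X * (1 - X) * derivative P

lemma eulerianPoly_succ (c : ℤ) (n : ℕ) :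
    eulerianPoly c (n + 1) = eulerianStep (n - 1 + c) (2 - c) (eulerianPoly c n) := by
  have hterm (k : ℕ) (hk : k ∈ Finset.range (n + 1)) :
      eulerianStep (n - 1 + c) (2 - c) (C (binomCoeff c n k) * (X - 1) ^ (n - k))
        = C ((2 * k + c) * binomCoeff c n k) * (X - 1) ^ (n + 1 - k)
          + C (2 * (k + 1) * binomCoeff c n k) * (X - 1) ^ (n - k) := by
    obtain ⟨e, rfl⟩ := Nat.exists_eq_add_of_le (Nat.lt_succ_iff.1 (Finset.mem_range.1 hk))
    rw [show k + e - k = e by omega, show k + e + 1 - k = e + 1 by omega, eulerianStep]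
    obtain _ | e := e
    · simp; ring
    · simp [derivative_pow]; ring
  have hlin : eulerianStep (n - 1 + c) (2 - c) (eulerianPoly c n)
      = ∑ k ∈ Finset.range (n + 1),
        eulerianStep (n - 1 + c) (2 - c) (C (binomCoeff c n k) * (X - 1) ^ (n - k)) := by
    simp only [eulerianStep, eulerianPoly, derivative_sum, Finset.mul_sum, Finset.sum_add_distrib]
  have h1 : ∑ k ∈ Finset.range (n + 1), C ((2 * k + c) * binomCoeff c n k) *
        (X - 1 : ℤ[X]) ^ (n + 1 - k)
      = ∑ k ∈ Finset.range (n + 2), C ((2 * k + c) * binomCoeff c n k) *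
        (X - 1 : ℤ[X]) ^ (n + 1 - k) := by
    rw [Finset.sum_range_succ _ (n + 1), binomCoeff_eq_zero c (Nat.lt_succ_self n)]; simp
  rw [hlin, Finset.sum_congr rfl hterm, Finset.sum_add_distrib, h1, Finset.sum_range_succ',
    eulerianPoly, Finset.sum_range_succ']
  simp only [binomCoeff, Nat.add_sub_add_right, map_add, add_mul, Finset.sum_add_distrib]
  push_cast
  simp
  ring

/-- `∑ᵢ gᵢ tⁱ (1 + t)^(D - 2i)`, the polynomial with `γ`-vector `g`. -/
noncomputable def gammaPoly (D : ℕ) (g : ℕ → ℤ) : ℤ[X] :=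
  ∑ i ∈ Finset.range (D + 1), C (g i) * X ^ i * (1 + X) ^ (D - 2 * i)

/-- The effect of `eulerianStep` on `γ`-vectors. -/
lemma eulerianStep_gammaPoly (D : ℕ) (r : ℤ) {g g' : ℕ → ℤ} (hg : ∀ i, D < 2 * i → g i = 0)
    (h0 : g' 0 = r * g 0)
    (h1 : ∀ i : ℕ, g' (i + 1) = (2 * (i + 1) + r) * g (i + 1) + 4 * (D - 2 * i) * g i) :
    eulerianStep D r (gammaPoly D g) = gammaPoly (D + 1) g' := by
  have hterm (i : ℕ) (_ : i ∈ Finset.range (D + 1)) :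
      eulerianStep D r (C (g i) * X ^ i * (1 + X) ^ (D - 2 * i))
        = C ((2 * i + r) * g i) * X ^ i * (1 + X) ^ (D + 1 - 2 * i)
          + C (4 * (D - 2 * i) * g i) * X ^ (i + 1) * (1 + X) ^ (D + 1 - 2 * (i + 1)) := by
    rcases lt_or_ge D (2 * i) with hi | hi
    · simp [hg i hi, eulerianStep]
    obtain ⟨e, rfl⟩ := Nat.exists_eq_add_of_le hi
    rw [show 2 * i + e - 2 * i = e by omega, show 2 * i + e + 1 - 2 * i = e + 1 by omega,
      show 2 * i + e + 1 - 2 * (i + 1) = e - 1 by omega, eulerianStep]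
    obtain _ | i := i <;> obtain _ | e := e <;> simp [derivative_pow] <;> ring
  have hlin : eulerianStep D r (gammaPoly D g) = ∑ i ∈ Finset.range (D + 1),
      eulerianStep D r (C (g i) * X ^ i * (1 + X) ^ (D - 2 * i)) := by
    simp only [eulerianStep, gammaPoly, derivative_sum, Finset.mul_sum, Finset.sum_add_distrib]
  have h2 : ∑ i ∈ Finset.range (D + 1),
        C ((2 * i + r) * g i) * X ^ i * (1 + X : ℤ[X]) ^ (D + 1 - 2 * i)
      = ∑ i ∈ Finset.range (D + 2),
        C ((2 * i + r) * g i) * X ^ i * (1 + X : ℤ[X]) ^ (D + 1 - 2 * i) := by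
    rw [Finset.sum_range_succ _ (D + 1), hg (D + 1) (by omega)]; simp
  rw [hlin, Finset.sum_congr rfl hterm, Finset.sum_add_distrib, h2, gammaPoly,
    Finset.sum_range_succ' _ (D + 1), Finset.sum_range_succ' _ (D + 1)]
  simp only [h0, h1, map_add, add_mul, Finset.sum_add_distrib]
  push_cast
  simp
  ring

/-! ### Peak numbers -/

mutual
/-- The number of permutations of `m + 1` letters that start with an ascent and have `j` interior
peaks, by the recursion that inserts the largest letter. The one-letter word counts as starting
with an ascent. -/
def peakAsc : ℕ → ℕ → ℤ
  | 0, 0 => 1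
  | 0, _ + 1 => 0
  | m + 1, 0 => peakAsc m 0
  | m + 1, j + 1 => (2 * j + 3) * peakAsc m (j + 1) + (m - 2 * j) * peakAsc m j + peakDesc m j
/-- The number of permutations of `m + 1` letters that start with a descent and have `j` interior
peaks, by the recursion that inserts the largest letter. -/
def peakDesc : ℕ → ℕ → ℤ
  | 0, _ => 0
  | m + 1, 0 => 2 * peakDesc m 0 + peakAsc m 0
  | m + 1, j + 1 =>
    (2 * j + 4) * peakDesc m (j + 1) + (m - 1 - 2 * j) * peakDesc m j + peakAsc m (j + 1)
end

lemma peak_eq_zero (m : ℕ) :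
    (∀ j, m < 2 * j → peakAsc m j = 0) ∧ ∀ j, m < 2 * j + 1 → peakDesc m j = 0 := by
  induction m with
  | zero =>
    refine ⟨fun j hj => ?_, fun j _ => by simp [peakDesc]⟩
    obtain _ | j := j
    · simp at hj
    · simp [peakAsc]
  | succ m ih =>
    refine ⟨fun j hj => ?_, fun j hj => ?_⟩ <;> obtain _ | j := j
    · simp at hj
    · rw [peakAsc, ih.1 (j + 1) (by omega), ih.2 j (by omega)]
      rcases Nat.lt_or_ge m (2 * j) with h | h
      · rw [ih.1 j h]; ring
      · rw [show m = 2 * j by omega]; push_cast; ring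
    · simp at hj
    · rw [peakDesc, ih.1 (j + 1) (by omega), ih.2 (j + 1) (by omega)]
      rcases Nat.lt_or_ge m (2 * j + 1) with h | h
      · rw [ih.2 j h]; ring
      · rw [show m = 2 * j + 1 by omega]; push_cast; ring

lemma peak_nonneg (m : ℕ) : (∀ j, 0 ≤ peakAsc m j) ∧ ∀ j, 0 ≤ peakDesc m j := by
  induction m with
  | zero => exact ⟨fun j => by obtain _ | j := j <;> simp [peakAsc], fun j => by simp [peakDesc]⟩
  | succ m ih =>
    have ha (j : ℕ) : 0 ≤ ((m : ℤ) - 2 * j) * peakAsc m j := by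
      rcases Nat.lt_or_ge m (2 * j) with h | h
      · simp [(peak_eq_zero m).1 j h]
      · exact mul_nonneg (by omega) (ih.1 j)
    have hd (j : ℕ) : 0 ≤ ((m : ℤ) - 1 - 2 * j) * peakDesc m j := by
      rcases Nat.lt_or_ge m (2 * j + 1) with h | h
      · simp [(peak_eq_zero m).2 j h]
      · exact mul_nonneg (by omega) (ih.2 j)
    refine ⟨fun j => ?_, fun j => ?_⟩ <;> obtain _ | j := j
    · rw [peakAsc]; exact ih.1 0
    · rw [peakAsc]
      have := ha j; have := ih.2 j
      have := mul_nonneg (by omega : (0 : ℤ) ≤ 2 * j + 3) (ih.1 (j + 1))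
      linarith
    · rw [peakDesc]; have := ih.1 0; have := ih.2 0; linarith
    · rw [peakDesc]
      have := hd j; have := ih.1 (j + 1)
      have := mul_nonneg (by omega : (0 : ℤ) ≤ 2 * j + 4) (ih.2 (j + 1))
      linarith

/-- A bound on the number of permutations starting with an ascent by the number of those starting
with a descent and having as many peaks, which drives the induction in `firstLetterSum_bounds`. -/
lemma mul_peakAsc_le_mul_peakDesc (m j : ℕ) :
    ((m : ℤ) - 2 * j) * peakAsc m j ≤ (m + 1) * peakDesc m j := by
  induction m generalizing j with
  | zero => obtain _ | j := j <;> simp [peakAsc, peakDesc]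
  | succ m ih =>
    obtain ⟨ha, hd⟩ := peak_nonneg m
    obtain ⟨ha0, hd0⟩ := peak_eq_zero m
    -- The consequence of the induction hypothesis at `j` that is needed. It holds also where
    -- `peakAsc` vanishes, although the coefficient in the hypothesis is then negative.
    have key (j : ℕ) : ((m : ℤ) + 1 - 2 * j) * (2 * j + 1) * peakAsc m j
        ≤ (m + 2) * ((2 * j + 2) * peakDesc m j + peakAsc m j) := by
      rcases Nat.lt_or_ge m (2 * j) with h | h
      · rw [ha0 j h]; have := hd j; simp only [mul_zero, add_zero]; positivity
      · have h1 := mul_le_mul_of_nonneg_left (ih j) (by omega : (0 : ℤ) ≤ 2 * j + 2)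
        have h2 : 0 ≤ (2 * (m : ℤ) + 1 - 4 * j) * peakAsc m j := mul_nonneg (by omega) (ha j)
        have h3 := mul_nonneg (by omega : (0 : ℤ) ≤ 2 * j + 2) (hd j)
        nlinarith
    obtain _ | j := j
    · have := key 0
      simp only [peakAsc, peakDesc]
      push_cast at this ⊢
      linarith
    · have h1 := key (j + 1)
      rw [peakAsc, peakDesc]
      rcases Nat.lt_or_ge m (2 * j + 1) with h | h
      · rw [ha0 (j + 1) (by omega), hd0 (j + 1) (by omega), hd0 j h]
        rcases Nat.lt_or_ge m (2 * j) with h' | h'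
        · rw [ha0 j h']; simp
        · rw [show m = 2 * j by omega]; push_cast; ring_nf; rfl
      · have h2 := mul_le_mul_of_nonneg_left (ih j) (by omega : (0 : ℤ) ≤ (m : ℤ) - 1 - 2 * j)
        push_cast at h1 ⊢
        linarith

/-- The sum of the first letters over the permutations counted by `peakAsc m j`, expressed by peak
numbers. -/
def firstLetterSum (m : ℕ) : ℕ → ℤ
  | 0 => peakAsc m 0
  | j + 1 => (2 * j + 3) * peakAsc m (j + 1) - (m - 1 - 2 * j) * peakDesc m j

lemma firstLetterSum_zero_succ (m : ℕ) : firstLetterSum (m + 1) 0 = peakAsc (m + 1) 0 := rfl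

lemma firstLetterSum_succ_succ (m j : ℕ) :
    firstLetterSum (m + 1) (j + 1) = 2 * (j + 1) * firstLetterSum m (j + 1)
      + peakAsc (m + 1) (j + 1) + (m - 2 * j) * firstLetterSum m j := by
  obtain _ | j := j <;> simp only [firstLetterSum, peakAsc, peakDesc] <;> push_cast <;> ring

/-- On average, the first letter of a permutation that starts with an ascent is at most
`(m + 2) / 2`, the average of all letters. -/
lemma firstLetterSum_bounds (m : ℕ) :
    ∀ j, 0 ≤ firstLetterSum m j ∧ 2 * firstLetterSum m j ≤ (m + 2) * peakAsc m j := by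
  induction m with
  | zero => intro j; obtain _ | _ | j := j <;> simp [firstLetterSum, peakAsc, peakDesc]
  | succ m ih =>
    intro j
    obtain ⟨ha, hd⟩ := peak_nonneg m
    obtain ⟨ha0, hd0⟩ := peak_eq_zero m
    have ha' := (peak_nonneg (m + 1)).1
    obtain _ | j := j
    · rw [firstLetterSum_zero_succ]
      have := ha' 0
      refine ⟨this, ?_⟩
      push_cast; nlinarith
    rw [firstLetterSum_succ_succ]
    rcases Nat.lt_or_ge m (2 * j) with h | h
    · have hz : firstLetterSum m j = 0 := by
        have := ih j; rw [ha0 j h] at this; linarith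
      have hz' : firstLetterSum m (j + 1) = 0 := by
        have := ih (j + 1); rw [ha0 (j + 1) (by omega)] at this; linarith
      rw [hz, hz']
      have := ha' (j + 1)
      refine ⟨by linarith, ?_⟩
      push_cast; nlinarith
    · have hc : (0 : ℤ) ≤ (m : ℤ) - 2 * j := by omega
      have h1 := mul_nonneg hc (ih j).1
      have h2 := mul_le_mul_of_nonneg_left (ih j).2 hc
      have h3 := mul_nonneg (by omega : (0 : ℤ) ≤ 2 * (j + 1)) (ih (j + 1)).1
      have h4 := mul_le_mul_of_nonneg_left (ih (j + 1)).2 (by omega : (0 : ℤ) ≤ 2 * (j + 1))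
      refine ⟨by have := ha' (j + 1); linarith, ?_⟩
      have h5 := mul_peakAsc_le_mul_peakDesc m j
      have h6 : 0 ≤ ((m : ℤ) - 1 - 2 * j) * peakAsc m (j + 1) := by
        rcases Nat.lt_or_ge m (2 * j + 1) with h | h
        · simp [ha0 (j + 1) (by omega)]
        · exact mul_nonneg (by omega) (ha _)
      rw [peakAsc]
      push_cast
      linarith

/-- The number of permutations of `m + 1` letters with `i` left peaks, that is peaks of the word
with a smallest letter put in front. -/
def leftPeak (m : ℕ) : ℕ → ℤ
  | 0 => peakAsc m 0
  | i + 1 => peakAsc m (i + 1) + peakDesc m i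

/-- At least half of the words obtained by putting a letter in front of a permutation of `m + 1`
letters with `i` interior peaks have `i + 1` left peaks. -/
lemma mul_peak_le_leftPeak (m i : ℕ) :
    (m + 2) * (peakAsc m i + peakDesc m i) ≤ 2 * leftPeak (m + 1) (i + 1) := by
  have h : leftPeak (m + 1) (i + 1) = (m + 2) * (peakAsc m i + peakDesc m i)
      - firstLetterSum m i + firstLetterSum m (i + 1) := by
    obtain _ | i := i <;> simp only [leftPeak, firstLetterSum, peakAsc, peakDesc] <;>
      push_cast <;> ring
  have h1 := firstLetterSum_bounds m i
  have h2 := (firstLetterSum_bounds m (i + 1)).1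
  have h3 := mul_nonneg (by positivity : (0 : ℤ) ≤ m + 2) ((peak_nonneg m).2 i)
  rw [h]
  linarith

lemma eulerianPoly_one_eq_gammaPoly (m : ℕ) :
    eulerianPoly 1 (m + 1) = gammaPoly (m + 1) fun i => 4 ^ i * leftPeak m i := by
  induction m with
  | zero =>
    simp [eulerianPoly, gammaPoly, Finset.sum_range_succ, binomCoeff, leftPeak, peakAsc, peakDesc]
    ring
  | succ m ih =>
    rw [eulerianPoly_succ, ih]
    have : ((m + 1 : ℕ) : ℤ) - 1 + 1 = (m + 1 : ℕ) := by ring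
    rw [this]
    refine eulerianStep_gammaPoly _ _ (fun i hi => ?_) ?_ fun i => ?_
    · obtain _ | i := i
      · simp at hi
      · rw [leftPeak, (peak_eq_zero m).1 _ (by omega), (peak_eq_zero m).2 _ (by omega)]; simp
    · simp [leftPeak, peakAsc]
    · obtain _ | i := i <;> simp only [leftPeak, peakAsc, peakDesc] <;> push_cast <;> ring

lemma eulerianPoly_zero_eq_gammaPoly (m : ℕ) : eulerianPoly 0 (m + 1)
    = gammaPoly m fun i => 2 * 4 ^ i * (peakAsc m i + peakDesc m i) := by
  induction m with
  | zero =>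
    simp [eulerianPoly, gammaPoly, Finset.sum_range_succ, binomCoeff, peakAsc, peakDesc]
  | succ m ih =>
    rw [eulerianPoly_succ, ih]
    have : ((m + 1 : ℕ) : ℤ) - 1 + 0 = (m : ℕ) := by push_cast; ring
    rw [this]
    refine eulerianStep_gammaPoly _ _ (fun i hi => ?_) ?_ fun i => ?_
    · rw [(peak_eq_zero m).1 _ hi, (peak_eq_zero m).2 _ (by omega)]; simp
    · simp [peakAsc, peakDesc]; ring
    · obtain _ | i := i <;> simp only [peakAsc, peakDesc] <;> push_cast <;> ring

/-! ### Counting faces by lattice points -/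

section Counting

variable {n : ℕ}

/-- The point of `ℝⁿ` with the given integer coordinates. -/
def toReal (x : Fin n → ℤ) : Fin n → ℝ := fun i => x i

/-- The nonzero absolute values of the coordinates of an integer point. -/
def natLevels (x : Fin n → ℤ) : Finset ℕ := (Finset.univ.image fun i => (x i).natAbs).erase 0

lemma mem_natLevels {x : Fin n → ℤ} {t : ℕ} : t ∈ natLevels x ↔ t ≠ 0 ∧ ∃ i, (x i).natAbs = t := by
  simp [natLevels]

lemma abs_toReal (x : Fin n → ℤ) (i : Fin n) : |toReal x i| = ((x i).natAbs : ℝ) := by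
  simp [toReal, Nat.cast_natAbs]

lemma card_levels_toReal (x : Fin n → ℤ) : (levels (toReal x)).card = (natLevels x).card := by
  have : levels (toReal x) = (natLevels x).map ⟨Nat.cast, Nat.cast_injective⟩ := by
    ext t
    simp only [mem_levels, Finset.mem_map, mem_natLevels, abs_toReal, Function.Embedding.coeFn_mk]
    constructor
    · rintro ⟨h0, i, rfl⟩
      exact ⟨_, ⟨by simpa using h0, i, rfl⟩, rfl⟩
    · rintro ⟨_, ⟨h0, i, rfl⟩, rfl⟩
      exact ⟨by simpa using h0, i, rfl⟩
  rw [this, Finset.card_map]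

lemma sign_toReal (x : Fin n → ℤ) (i : Fin n) :
    SignType.sign (toReal x i) = SignType.sign (x i) := by
  rcases lt_trichotomy (x i) 0 with h | h | h
  · rw [sign_neg h]; exact sign_neg (Int.cast_lt_zero.2 h)
  · simp [toReal, h]
  · rw [sign_pos h]; exact sign_pos (Int.cast_pos.2 h)

/-- An integer point is determined by its type and its levels. -/
lemma eq_of_sameType_of_natLevels_eq {x y : Fin n → ℤ} (h : SameType (toReal x) (toReal y))
    (hl : natLevels x = natLevels y) : x = y := by
  have hle (i j) : (x i).natAbs ≤ (x j).natAbs ↔ (y i).natAbs ≤ (y j).natAbs := by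
    have := h.2 i j
    rw [abs_toReal, abs_toReal, abs_toReal, abs_toReal] at this
    exact_mod_cast this
  have hsign (i) : SignType.sign (x i) = SignType.sign (y i) := by
    rw [← sign_toReal, ← sign_toReal, h.1 i]
  have h0 (i) : x i = 0 ↔ y i = 0 := by
    rw [← sign_eq_zero_iff, hsign i, sign_eq_zero_iff]
  choose p hp using fun t : natLevels x => (mem_natLevels.1 t.2).2
  have hmono : StrictMono fun t : natLevels x => (y (p t)).natAbs := fun t t' htt' => by
    refine lt_of_not_ge fun hge => ?_
    have := (hle _ _).2 hge
    rw [hp, hp] at this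
    exact htt'.not_ge this
  have hp' {i} (hi : (x i).natAbs ∈ natLevels x) :
      (y (p ⟨_, hi⟩)).natAbs = (y i).natAbs := by
    have := hp ⟨_, hi⟩
    exact ((hle _ _).1 this.le).antisymm ((hle _ _).1 this.ge)
  have hrange : Set.range (fun t : natLevels x => (y (p t)).natAbs)
      = Set.range (Subtype.val : natLevels x → ℕ) := by
    rw [Subtype.range_coe]
    ext t
    constructor
    · rintro ⟨t, rfl⟩
      refine (Finset.ext_iff.1 hl _).2 (mem_natLevels.2 ⟨fun hz => ?_, _, rfl⟩)
      have := (h0 (p t)).2 (Int.natAbs_eq_zero.1 hz)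
      have h1 := hp t
      rw [this] at h1
      exact (mem_natLevels.1 t.2).1 h1.symm
    · intro ht
      have ht : t ∈ natLevels x := ht
      rw [hl, mem_natLevels] at ht
      obtain ⟨ht, i, rfl⟩ := ht
      have hi : (x i).natAbs ∈ natLevels x := mem_natLevels.2 ⟨fun hz => ht (by
        rw [(h0 i).1 (Int.natAbs_eq_zero.1 hz)]; rfl), i, rfl⟩
      exact ⟨⟨_, hi⟩, hp' hi⟩
  have hfun := (hmono.range_inj (Subtype.strictMono_coe _)).1 hrange
  ext i
  by_cases hi : x i = 0
  · rw [hi, (h0 i).1 hi]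
  have hmem : (x i).natAbs ∈ natLevels x := mem_natLevels.2 ⟨Int.natAbs_ne_zero.2 hi, i, rfl⟩
  have habs : (y i).natAbs = (x i).natAbs := by
    rw [← hp' hmem]; exact congrFun hfun ⟨_, hmem⟩
  rw [← sign_mul_abs (x i), ← sign_mul_abs (y i), hsign i, Int.abs_eq_natAbs, Int.abs_eq_natAbs,
    habs]

/-- Every type of points with `k` levels contains an integer point with any given `k` levels. -/
lemma exists_sameType_natLevels_eq (y : Fin n → ℝ) {T : Finset ℕ} (hT : T.card = (levels y).card)
    (h0 : 0 ∉ T) : ∃ x : Fin n → ℤ, SameType y (toReal x) ∧ natLevels x = T := by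
  let e : levels y ≃o T := ((levels y).orderIsoOfFin rfl).symm.trans (T.orderIsoOfFin hT)
  let E : ℝ → ℕ := fun t => if h : t ∈ levels y then e ⟨t, h⟩ else 0
  have hE {t : ℝ} (h : t ∈ levels y) : E t = e ⟨t, h⟩ := dif_pos h
  have hE0 : E 0 = 0 := dif_neg fun h => (mem_levels.1 h).1 rfl
  have hEpos {t : ℝ} (h : t ∈ levels y) : 0 < E t := by
    rw [hE h]
    exact Nat.pos_of_ne_zero fun h' => h0 (h' ▸ (e ⟨t, h⟩).2)
  let x : Fin n → ℤ := fun i => SignType.sign (y i) * (E |y i| : ℤ)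
  have hx0 {i} (hi : y i = 0) : x i = 0 := by simp [x, hi]
  have habs (i) : (x i).natAbs = E |y i| := by
    rcases lt_trichotomy (y i) 0 with h | h | h
    · simp [x, sign_neg h]
    · simp [x, h, hE0]
    · simp [x, sign_pos h]
  refine ⟨x, ⟨fun i => ?_, fun i j => ?_⟩, ?_⟩
  · rw [sign_toReal]
    by_cases h : y i = 0
    · rw [h, hx0 h, sign_zero, sign_zero]
    · have := hEpos (abs_mem_levels h)
      rcases lt_or_gt_of_ne h with h | h
      · rw [sign_neg h, sign_neg]
        simp only [x, sign_neg h]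
        simpa using this
      · rw [sign_pos h, sign_pos]
        simp only [x, sign_pos h]
        simpa using this
  · rw [abs_toReal, abs_toReal, Nat.cast_le, habs, habs]
    by_cases hi : y i = 0
    · simp [hi, hE0]
    by_cases hj : y j = 0
    · simp [hj, hE0, hi, (hEpos (abs_mem_levels hi)).ne']
    rw [hE (abs_mem_levels hi), hE (abs_mem_levels hj), Subtype.coe_le_coe, e.le_iff_le,
      Subtype.mk_le_mk]
  · ext t
    rw [mem_natLevels]
    constructor
    · rintro ⟨ht, i, rfl⟩
      have hi : y i ≠ 0 := fun hi => ht (by rw [hx0 hi]; rfl)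
      rw [habs, hE (abs_mem_levels hi)]
      exact (e _).2
    · intro ht
      obtain ⟨hne, i, hi⟩ := mem_levels.1 (e.symm ⟨t, ht⟩).2
      refine ⟨fun h => h0 (h ▸ ht), i, ?_⟩
      rw [habs, hi, hE (e.symm ⟨t, ht⟩).2]
      simp

/-- The integer points with coordinates of absolute value at most `m`. -/
noncomputable def box (n m : ℕ) : Finset (Fin n → ℤ) :=
  Fintype.piFinset fun _ => Finset.Icc (-(m : ℤ)) m

lemma mem_box {m : ℕ} {x : Fin n → ℤ} : x ∈ box n m ↔ ∀ i, (x i).natAbs ≤ m := by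
  simp only [box, Fintype.mem_piFinset, Finset.mem_Icc]
  exact forall_congr' fun i => by omega

open Classical in
/-- The normalized integer points in a box. -/
noncomputable def normalizedBox (n s m : ℕ) : Finset (Fin n → ℤ) :=
  (box n m).filter fun x => Normalized s (toReal x)

lemma mem_normalizedBox {s m : ℕ} {x : Fin n → ℤ} :
    x ∈ normalizedBox n s m ↔ x ∈ box n m ∧ Normalized s (toReal x) := by
  classical
  simp [normalizedBox]

/-- The relative interior of a `k`-dimensional face contains one normalized integer point for each
choice of `k` levels. -/
lemma card_normalizedBox_filter (n s m k : ℕ) :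
    ((normalizedBox n s m).filter fun x => (natLevels x).card = k).card
      = (facesOfDim (normals n s) k).ncard * m.choose k := by
  have himage : (fun x : Fin n → ℤ => (face (normals n s) (toReal x), natLevels x)) ''
      ((normalizedBox n s m).filter fun x => (natLevels x).card = k)
      = facesOfDim (normals n s) k ×ˢ
        (Finset.powersetCard k (Finset.Icc 1 m) : Set (Finset ℕ)) := by
    ext ⟨K, T⟩
    simp only [Set.mem_image, Finset.mem_coe, Finset.mem_filter, Prod.mk.injEq, Set.mem_prod,
      Finset.mem_powersetCard, mem_normalizedBox]
    constructor
    · rintro ⟨x, ⟨⟨hbox, hx⟩, hk⟩, rfl, rfl⟩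
      refine ⟨⟨⟨_, rfl⟩, ?_⟩, fun t ht => ?_, hk⟩
      · rw [finrank_span_face_normals hx, card_levels_toReal, hk]
      · obtain ⟨h0, i, rfl⟩ := mem_natLevels.1 ht
        exact Finset.mem_Icc.2 ⟨Nat.pos_of_ne_zero h0, mem_box.1 hbox i⟩
    · rintro ⟨⟨⟨y', rfl⟩, hdim⟩, hTm, hT⟩
      obtain ⟨y, hy, hface⟩ := exists_normalized s y'
      rw [← hface, finrank_span_face_normals hy] at hdim
      obtain ⟨x, hyx, rfl⟩ := exists_sameType_natLevels_eq y (hT.trans hdim.symm) fun h0 => by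
        simpa using hTm h0
      have hx := hyx.normalized hy
      refine ⟨x, ⟨⟨mem_box.2 fun i => ?_, hx⟩, hT⟩, ?_, rfl⟩
      · by_cases hi : x i = 0
        · simp [hi]
        · exact (Finset.mem_Icc.1 (hTm (mem_natLevels.2 ⟨Int.natAbs_ne_zero.2 hi, i, rfl⟩))).2
      · rw [← hface, (face_eq_iff_sameType hx hy).2 hyx.symm]
  have hinj : Set.InjOn (fun x : Fin n → ℤ => (face (normals n s) (toReal x), natLevels x))
      ((normalizedBox n s m).filter fun x => (natLevels x).card = k) := by
    intro x hx y hy hxy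
    simp only [Finset.coe_filter, Set.mem_ofPred_eq, mem_normalizedBox] at hx hy
    obtain ⟨h1, h2⟩ := Prod.mk.inj hxy
    exact eq_of_sameType_of_natLevels_eq ((face_eq_iff_sameType hx.1.2 hy.1.2).1 h1) h2
  rw [← Set.ncard_coe_finset, ← hinj.ncard_image, himage, Set.ncard_prod, Set.ncard_coe_finset,
    Finset.card_powersetCard, Nat.card_Icc, Nat.add_sub_cancel]

lemma card_normalizedBox (n s m : ℕ) : (normalizedBox n s m).card
    = ∑ k ∈ Finset.range (n + 1), (facesOfDim (normals n s) k).ncard * m.choose k := by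
  rw [Finset.card_eq_sum_card_fiberwise (f := fun x => (natLevels x).card)
    (t := Finset.range (n + 1)) fun x _ => ?_]
  · exact Finset.sum_congr rfl fun k _ => card_normalizedBox_filter n s m k
  · simp only [Finset.coe_range, Set.mem_Iio, Nat.lt_succ_iff]
    exact ((Finset.card_erase_le).trans Finset.card_image_le).trans (by simp)

lemma card_filter_lt_natAbs {m c : ℕ} (hc : c ≤ m) :
    ((Finset.Icc (-(m : ℤ)) m).filter fun z => c < z.natAbs).card = 2 * (m - c) := by
  have : (Finset.Icc (-(m : ℤ)) m).filter (fun z => c < z.natAbs)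
      = Finset.Icc (-(m : ℤ)) m \ Finset.Icc (-(c : ℤ)) c := by
    ext z; simp only [Finset.mem_filter, Finset.mem_sdiff, Finset.mem_Icc]; omega
  rw [this, Finset.card_sdiff_of_subset (Finset.Icc_subset_Icc (by omega) (by omega)), Int.card_Icc,
    Int.card_Icc]
  omega

/-- The points of the box at which normalization fails because of the coordinate `i`. -/
noncomputable def badBox (m : ℕ) (i : Fin n) : Finset (Fin n → ℤ) :=
  (box n m).filter fun x => x i ≤ 0 ∧ ∀ j, j ≠ i → (x i).natAbs < (x j).natAbs

/-- For each value `-c` of the coordinate `i`, the other `n - 1` coordinates have `2 (m - c)` values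
each. -/
lemma card_badBox (m : ℕ) (i : Fin n) :
    (badBox m i).card = ∑ c ∈ Finset.range (m + 1), (2 * c) ^ (n - 1) := by
  rw [Finset.card_eq_sum_card_fiberwise (f := fun x => (x i).natAbs) (t := Finset.range (m + 1))
    fun x hx => ?_, ← Finset.sum_range_reflect fun c => (2 * c) ^ (n - 1)]
  · refine Finset.sum_congr rfl fun c hc => ?_
    have hcm : c ≤ m := Nat.lt_succ_iff.1 (Finset.mem_range.1 hc)
    have hset : (badBox m i).filter (fun x => (x i).natAbs = c)
        = Fintype.piFinset (Function.update
          (fun _ => (Finset.Icc (-(m : ℤ)) m).filter fun z => c < z.natAbs) i {-(c : ℤ)}) := by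
      ext x
      simp only [badBox, Finset.mem_filter, mem_box, Fintype.mem_piFinset]
      constructor
      · rintro ⟨⟨hb, h0, h⟩, hi⟩ j
        by_cases hj : j = i
        · subst hj
          simp only [Function.update_self, Finset.mem_singleton]
          omega
        · have := h j hj
          have := hb j
          rw [Function.update_of_ne hj, Finset.mem_filter, Finset.mem_Icc]
          omega
      · intro h
        have hi : x i = -(c : ℤ) := by simpa using h i
        have h' : ∀ j, j ≠ i → (x j).natAbs ≤ m ∧ c < (x j).natAbs := fun j hj => by
          have := h j
          rw [Function.update_of_ne hj, Finset.mem_filter, Finset.mem_Icc] at this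
          omega
        refine ⟨⟨fun j => ?_, by omega, fun j hj => ?_⟩, by omega⟩
        · by_cases hj : j = i
          · rw [hj]; omega
          · exact (h' j hj).1
        · have := (h' j hj).2; omega
    rw [hset, Fintype.card_piFinset, ← Finset.prod_erase_mul _ _ (Finset.mem_univ i),
      Function.update_self, Finset.card_singleton, mul_one,
      Finset.prod_congr rfl fun j hj => by
        rw [Function.update_of_ne (Finset.ne_of_mem_erase hj), card_filter_lt_natAbs hcm],
      Finset.prod_const, Finset.card_erase_of_mem (Finset.mem_univ i), Finset.card_univ,
      Fintype.card_fin]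
    simp
  · have := (mem_box.1 (Finset.mem_filter.1 hx).1) i
    simpa [Nat.lt_succ_iff] using this

lemma card_normalizedBox_add (n s m : ℕ) (hs : s ≤ n) :
    (normalizedBox n s m).card + (n - s) * ∑ c ∈ Finset.range (m + 1), (2 * c) ^ (n - 1)
      = (2 * m + 1) ^ n := by
  classical
  have hbox : (box n m).card = (2 * m + 1) ^ n := by
    rw [box, Fintype.card_piFinset, Finset.prod_const, Finset.card_univ, Fintype.card_fin,
      Int.card_Icc]
    congr 1
    omega
  have hpos (x : Fin n → ℤ) (i : Fin n) : 0 < toReal x i ↔ 0 < x i := Int.cast_pos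
  have hbad : (box n m).filter (fun x => ¬Normalized s (toReal x))
      = (Finset.univ.filter fun i : Fin n => s ≤ i).biUnion (badBox m) := by
    ext x
    simp only [Finset.mem_filter, Finset.mem_biUnion, Finset.mem_univ, true_and, badBox, Normalized,
      abs_toReal, Nat.cast_lt, not_forall, hpos, not_lt]
    constructor
    · rintro ⟨hb, i, hi, h, h0⟩
      exact ⟨i, hi, hb, h0, h⟩
    · rintro ⟨i, hi, hb, h0, h⟩
      exact ⟨hb, i, hi, h, h0⟩
  have hdisj : ((Finset.univ.filter fun i : Fin n => s ≤ i : Finset (Fin n)) :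
      Set (Fin n)).PairwiseDisjoint (badBox m) := by
    intro i _ j _ hij
    refine Finset.disjoint_left.2 fun x hi hj => ?_
    have h1 := (Finset.mem_filter.1 hi).2.2 j (Ne.symm hij)
    have h2 := (Finset.mem_filter.1 hj).2.2 i hij
    omega
  have hcard : (Finset.univ.filter fun i : Fin n => s ≤ i).card = n - s := by
    have h1 := Finset.card_filter_add_card_filter_not (s := (Finset.univ : Finset (Fin n)))
      (fun i => (i : ℕ) < s)
    simp only [not_lt, Finset.card_univ, Fintype.card_fin, Fin.card_filter_val_lt] at h1
    omega
  rw [← hbox, ← Finset.card_filter_add_card_filter_not (s := box n m)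
      (fun x => Normalized s (toReal x)), hbad,
    Finset.card_biUnion hdisj, Finset.sum_congr rfl fun i _ => card_badBox m i, Finset.sum_const,
    hcard, smul_eq_mul]
  rfl

lemma sum_choose_range (m k : ℕ) :
    ∑ c ∈ Finset.range (m + 1), c.choose k = (m + 1).choose (k + 1) := by
  induction m with
  | zero => obtain _ | k := k <;> simp [Nat.choose_eq_zero_of_lt]
  | succ m ih => rw [Finset.sum_range_succ, ih, Nat.choose_succ_succ (m + 1) k, add_comm]

/-- The face numbers of the intermediate arrangements. -/
lemma ncard_facesOfDim {n s k : ℕ} (hs : s ≤ n + 1) (hk : k < n + 2) :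
    ((facesOfDim (normals (n + 1) s) k).ncard : ℤ)
      = binomCoeff 1 (n + 1) k - (n + 1 - s) * (binomCoeff 0 n k +
        if k = 0 then 0 else binomCoeff 0 n (k - 1)) := by
  refine eq_of_sum_choose_eq (N := n + 2)
    (f := fun k => ((facesOfDim (normals (n + 1) s) k).ncard : ℤ))
    (g := fun k => binomCoeff 1 (n + 1) k - (n + 1 - s) * (binomCoeff 0 n k +
        if k = 0 then 0 else binomCoeff 0 n (k - 1))) (fun m => ?_) hk
  have h1 := card_normalizedBox_add (n + 1) s m hs
  rw [card_normalizedBox] at h1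
  zify [hs] at h1
  have h2 := sum_binomCoeff 1 (n + 1) m
  have h3 : ∑ c ∈ Finset.range (m + 1), (2 * (c : ℤ)) ^ n
      = ∑ k ∈ Finset.range (n + 2), (binomCoeff 0 n k +
        if k = 0 then 0 else binomCoeff 0 n (k - 1)) * (m.choose k : ℤ) := by
    calc ∑ c ∈ Finset.range (m + 1), (2 * (c : ℤ)) ^ n
        = ∑ c ∈ Finset.range (m + 1), ∑ k ∈ Finset.range (n + 1),
            binomCoeff 0 n k * (c.choose k : ℤ) :=
          Finset.sum_congr rfl fun c _ => by rw [sum_binomCoeff, add_zero]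
      _ = ∑ k ∈ Finset.range (n + 1), binomCoeff 0 n k * ((m.choose k : ℤ) + m.choose (k + 1)) := by
          rw [Finset.sum_comm]
          refine Finset.sum_congr rfl fun k _ => ?_
          rw [← Finset.mul_sum]
          congr 1
          exact_mod_cast (sum_choose_range m k).trans (Nat.choose_succ_succ m k)
      _ = _ := by
          simp only [mul_add, add_mul, Finset.sum_add_distrib]
          rw [Finset.sum_range_succ _ (n + 1), binomCoeff_eq_zero 0 (Nat.lt_succ_self n), zero_mul,
            add_zero, Finset.sum_range_succ' _ (n + 1)]
          simp
  simp only [sub_mul _ (_ * _), Finset.sum_sub_distrib, mul_assoc (_ - _)]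
  rw [← Finset.mul_sum, h2, ← h3]
  simp only [Nat.add_sub_cancel] at h1
  linear_combination h1

lemma sum_facesOfDim {n s : ℕ} (hs : s ≤ n + 1) :
    ∑ k ∈ Finset.range (n + 1 + 1), C ((facesOfDim (normals (n + 1) s) k).ncard : ℤ) *
      (X - 1) ^ (n + 1 - k)
        = eulerianPoly 1 (n + 1) - C (n + 1 - s : ℤ) * X * eulerianPoly 0 n := by
  have h1 : X * eulerianPoly 0 n = ∑ k ∈ Finset.range (n + 2), C (binomCoeff 0 n k +
      if k = 0 then 0 else binomCoeff 0 n (k - 1)) * (X - 1 : ℤ[X]) ^ (n + 1 - k) := by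
    simp only [map_add, add_mul, Finset.sum_add_distrib]
    rw [Finset.sum_range_succ _ (n + 1), binomCoeff_eq_zero 0 (Nat.lt_succ_self n), map_zero,
      zero_mul, add_zero, Finset.sum_range_succ' _ (n + 1)]
    simp only [if_true, map_zero, zero_mul, add_zero, Nat.add_sub_cancel, Nat.succ_ne_zero,
      if_false, Nat.add_sub_add_right, eulerianPoly, Finset.mul_sum]
    rw [← Finset.sum_add_distrib]
    refine Finset.sum_congr rfl fun k hk => ?_
    rw [Nat.sub_add_comm (Nat.lt_succ_iff.1 (Finset.mem_range.1 hk)), pow_succ]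
    ring
  rw [mul_assoc, h1, eulerianPoly, Finset.mul_sum, ← Finset.sum_sub_distrib]
  refine Finset.sum_congr rfl fun k hk => ?_
  rw [ncard_facesOfDim hs (Finset.mem_range.1 hk), map_sub, map_mul]
  ring

/-! ### The `γ`-vector -/

/-- The `γ`-vector of `intermediate (n + 1) s`. For `n = 0` it is meant for `s = 1` only. -/
def gammaCoeff (n s : ℕ) : ℕ → ℤ
  | 0 => leftPeak n 0
  | i + 1 => 4 ^ (i + 1) * leftPeak n (i + 1)
      - (n + 1 - s) * (2 * 4 ^ i * (peakAsc (n - 1) i + peakDesc (n - 1) i))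

lemma gammaCoeff_nonneg {n s : ℕ} (hn : n ≠ 0 ∨ s = 1) (i : ℕ) : 0 ≤ gammaCoeff n s i := by
  obtain _ | i := i
  · exact (peak_nonneg n).1 0
  rw [gammaCoeff]
  obtain _ | n := n
  · obtain rfl := hn.resolve_left fun h => h rfl
    simp [leftPeak, peakAsc, peakDesc]
  · have h1 := mul_peak_le_leftPeak n i
    have h2 : 0 ≤ peakAsc n i + peakDesc n i :=
      add_nonneg ((peak_nonneg n).1 i) ((peak_nonneg n).2 i)
    have h3 : ((n + 1 : ℕ) + 1 - s : ℤ) * (peakAsc n i + peakDesc n i)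
        ≤ (n + 2) * (peakAsc n i + peakDesc n i) :=
      mul_le_mul_of_nonneg_right (by push_cast; linarith [(Int.natCast_nonneg s)]) h2
    have h4 : (0 : ℤ) ≤ 2 * 4 ^ i := by positivity
    have h5 := mul_nonneg h4 (sub_nonneg.2 (h3.trans h1))
    rw [Nat.add_sub_cancel]
    rw [pow_succ]
    linarith

lemma gammaCoeff_eq_zero {n s i : ℕ} (hn : n ≠ 0 ∨ s = 1) (hi : n + 1 < 2 * i) :
    gammaCoeff n s i = 0 := by
  obtain _ | i := i
  · simp at hi
  rw [gammaCoeff, leftPeak, (peak_eq_zero n).1 _ (by omega), (peak_eq_zero n).2 _ (by omega)]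
  obtain _ | n := n
  · obtain rfl := hn.resolve_left fun h => h rfl
    simp
  rw [(peak_eq_zero (n + 1 - 1)).1 _ (by omega), (peak_eq_zero (n + 1 - 1)).2 _ (by omega)]
  simp

lemma eulerianPoly_sub_eq_gammaPoly {n s : ℕ} (hn : n ≠ 0 ∨ s = 1) :
    eulerianPoly 1 (n + 1) - C (n + 1 - s : ℤ) * X * eulerianPoly 0 n
      = gammaPoly (n + 1) (gammaCoeff n s) := by
  rw [eulerianPoly_one_eq_gammaPoly]
  obtain _ | n := n
  · obtain rfl := hn.resolve_left fun h => h rfl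
    simp [gammaPoly, Finset.sum_range_succ, gammaCoeff, leftPeak, peakAsc, peakDesc]
  · have hshift : X * eulerianPoly 0 (n + 1) = ∑ i ∈ Finset.range (n + 2),
        C (2 * 4 ^ i * (peakAsc n i + peakDesc n i)) * X ^ (i + 1) *
          (1 + X) ^ (n + 2 - 2 * (i + 1)) := by
      rw [eulerianPoly_zero_eq_gammaPoly, gammaPoly, Finset.sum_range_succ _ (n + 1),
        (peak_eq_zero n).1 (n + 1) (by omega), (peak_eq_zero n).2 (n + 1) (by omega),
        Finset.mul_sum]
      simp only [add_zero, mul_zero, map_zero, zero_mul]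
      refine Finset.sum_congr rfl fun i _ => ?_
      rw [show n + 2 - 2 * (i + 1) = n - 2 * i by omega, pow_succ]
      ring
    rw [mul_assoc, hshift, gammaPoly, gammaPoly, Finset.sum_range_succ' _ (n + 1 + 1),
      Finset.sum_range_succ' _ (n + 1 + 1),
      add_sub_right_comm, Finset.mul_sum, ← Finset.sum_sub_distrib]
    congr 1
    · refine Finset.sum_congr rfl fun i _ => ?_
      simp only [gammaCoeff, Nat.add_sub_cancel, map_sub, map_mul (C : ℤ →+* ℤ[X]) (_ - _)]
      ring
    · simp [gammaCoeff]

end Counting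

end HypArr

theorem mainTheorem3 (n s : ℕ) (hs : s ≤ n) (hne : (HypArr.intermediate n s).Nonempty) :
    HypArr.IsSimplicial (HypArr.intermediate n s) ∧
      HypArr.IsGammaPositive (HypArr.complex (HypArr.intermediate n s)) := by
  open HypArr Polynomial in
  obtain ⟨n, rfl⟩ : ∃ n', n = n' + 1 := by
    obtain ⟨_, ⟨i, -⟩ | ⟨i, -⟩⟩ := hne <;> exact ⟨n - 1, by have := i.2; omega⟩
  have hn : n ≠ 0 ∨ s = 1 := by
    by_contra! h
    obtain ⟨rfl, h⟩ := h
    obtain ⟨_, ⟨i, j, hij, -⟩ | ⟨i, hi, -⟩⟩ := hne <;> omega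
  rw [intermediate_eq]
  obtain ⟨u, hu⟩ := exists_generic (n + 1) s
  have hss : HasSimpleSystems (normals (n + 1) s) := hasSimpleSystems_normals (by omega)
  refine ⟨hss.isSimplicial, fun i => gammaCoeff n s i, ?_, fun i => gammaCoeff_nonneg hn i⟩
  rw [IsGammaVector, hss.hPoly_complex (finite_normals _ _) hu, sum_facesOfDim hs,
    eulerianPoly_sub_eq_gammaPoly hn, gammaPoly,
    Fin.sum_univ_eq_sum_range (fun i => C (gammaCoeff n s i) * X ^ i * (1 + X) ^
      (size (complex (hyperplane '' normals (n + 1) s)) - 2 * i)),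
    hss.size_complex (finite_normals _ _) hu]
  refine (Finset.sum_subset (Finset.range_subset_range.2 (by omega)) fun i _ hi => ?_).symm
  rw [gammaCoeff_eq_zero hn (by rw [Finset.mem_range] at hi; omega)]
  simp
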